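/- For a graph $H$, a family $\mathcal F$ of graphs and a positive integer $n$, let $ex(n,H,\mathcal F)$ denote the maximum number of copies of $H$ (that is, subgraphs isomorphic to $H$) in a simple graph on $n$ vertices that contains no member of $\mathcal F$ as a (not necessarily induced) subgraph. Let $C_m$ denote the cycle of length $m$. Then for any integers $k > l \ge 2$, as $n \to \infty$, $$\Omega\left(n^{1+\frac{1}{2k+1}}\right) = ex\left(n, C_{2l+1}, \{C_3, C_4, \ldots, C_{2l}\} \cup \{C_{2k}\}\right) = O\left(n^{1+\frac{l}{l+1}}\right),$$ where the implied constants may depend on $k$ and $l$ but not on $n$. -/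

import Mathlib

open Filter Asymptotics

/-- The family of cycles `{C_a : a ∈ A}`, as a set of finite graphs. -/
def cycleFamily (A : Set ℕ) : Set (Σ m : ℕ, SimpleGraph (Fin m)) :=
  {F | ∃ a ∈ A, F = ⟨a, SimpleGraph.cycleGraph a⟩}

/-- A graph is `ℱ`-free if it contains no member of `ℱ` as a (not necessarily induced) subgraph. -/
def FamilyFree (ℱ : Set (Σ m : ℕ, SimpleGraph (Fin m))) {V : Type*} (G : SimpleGraph V) : Prop :=
  ∀ F ∈ ℱ, F.2.Free G

/-- The generalized Turán number `ex(n, H, ℱ)`: the maximum number of copies of `H`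
(subgraphs isomorphic to `H`) in an `ℱ`-free graph on `n` vertices. -/
noncomputable def generalizedTuran (n : ℕ) {W : Type*} (H : SimpleGraph W)
    (ℱ : Set (Σ m : ℕ, SimpleGraph (Fin m))) : ℕ :=
  sSup {N : ℕ | ∃ G : SimpleGraph (Fin n), FamilyFree ℱ G ∧ G.copyCount H = N}

/-- The supremum is a maximum as soon as some `ℱ`-free graph on `n` vertices exists. -/
theorem generalizedTuran_isGreatest (n : ℕ) {W : Type*} (H : SimpleGraph W)
    (ℱ : Set (Σ m : ℕ, SimpleGraph (Fin m))) (h : ∃ G : SimpleGraph (Fin n), FamilyFree ℱ G) :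
    IsGreatest {N : ℕ | ∃ G : SimpleGraph (Fin n), FamilyFree ℱ G ∧ G.copyCount H = N}
      (generalizedTuran n H ℱ) := by
  have hfin : {N : ℕ | ∃ G : SimpleGraph (Fin n), FamilyFree ℱ G ∧ G.copyCount H = N}.Finite :=
    (Set.finite_range fun G : SimpleGraph (Fin n) => G.copyCount H).subset
      (by rintro _ ⟨G, _, rfl⟩; exact ⟨G, rfl⟩)
  obtain ⟨G, hG⟩ := h
  exact ⟨Nat.sSup_mem ⟨_, G, hG, rfl⟩ hfin.bddAbove, fun N hN => le_csSup hfin.bddAbove hN⟩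

/-! Upper bound. Suppose there is no cycle of length at most 2l and no C_{2k}, with l < k. The edges
joining level l around a vertex v to vertices at distance at least l are linearly few in the number
of vertices involved (`sum_card_adj_level_le`): a denser configuration contains a path that closes
up to a C_{2k} through the breadth-first tree. This is used twice. It bounds by O(n) the
non-backtracking continuations of length l + 1 of any arc (`nonBacktrackingCount_succ_le`). Also, a
(2l+1)-cycle through v is determined by its edge opposite v, which joins two vertices of level l;
hence for each arc from x to v the number of cycles at v is at most a constant times the number of
continuations of length l (`card_labelledCyclesAt_le`).

If every non-isolated vertex lay on at least that constant times Q cycles, each arc would have at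
least Q continuations of length l. Cutting walks of length l(l+1) into blocks of length l, or of
length l + 1, would give Q^(l+1) ≤ O(n)^l. So for a suitable Q of order n^(l/(l+1)) some
non-isolated vertex lies on O(Q) cycles; deleting such vertices one by one gives the bound.

Lower bound. Copies of C_{2l+1} are added greedily through vertices pairwise at distance more than
2k. A cycle mixing old and new edges is then longer than 2k, so no forbidden cycle appears
(`cycleGraph_free_sup_map`). If each vertex is used at most M times, with M of order n^(1/(2k+1)),
balls of radius 2k stay small enough to place order nM copies (`exists_graph_many_cycles`). -/

namespace SimpleGraph

/-! ### Paths, short cycles and iterated parents -/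

variable {V : Type*} {G : SimpleGraph V}

/-- A path whose endpoints are adjacent closes up to a cycle. -/
theorem cycleGraph_isContained_of_isPath {a b : V} (p : G.Walk a b) (hp : p.IsPath)
    (hab : G.Adj b a) (m : ℕ) (hm : p.length + 1 = m) : cycleGraph m ⊑ G := by
  subst hm
  refine ⟨⟨⟨fun i => p.getVert i, ?_⟩, ?_⟩⟩
  · intro i j hij
    have key : ∀ i j : Fin (p.length + 1), (i - j).val = 1 → G.Adj (p.getVert j) (p.getVert i) := by
      intro i j h
      rw [Fin.val_sub] at h
      rcases Nat.lt_or_ge j.val i.val with hlt | hge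
      · have h1 : (p.length + 1 - j.val + i.val) = (i.val - j.val) + (p.length + 1) := by omega
        rw [h1, Nat.add_mod_right, Nat.mod_eq_of_lt (by omega)] at h
        have h2 : i.val = j.val + 1 := by omega
        rw [h2]
        exact p.adj_getVert_succ (by omega)
      · rcases Nat.eq_or_lt_of_le hge with heq | hlt
        · have h1 : (p.length + 1 - j.val + i.val) = p.length + 1 := by omega
          rw [h1, Nat.mod_self] at h
          omega
        · rw [Nat.mod_eq_of_lt (by omega)] at h
          have h1 : j.val = p.length := by omega
          have h2 : i.val = 0 := by omega
          rw [h1, h2]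
          simpa using hab
    rcases cycleGraph_adj'.1 hij with h | h
    · exact (key i j h).symm
    · exact key j i h
  · intro i j hij
    exact Fin.ext (hp.getVert_injOn (by simp; omega) (by simp; omega) hij)

theorem Walk.IsPath.append_of_inter {a b c : V} {p : G.Walk a b} {q : G.Walk b c}
    (hp : p.IsPath) (hq : q.IsPath) (h : ∀ u ∈ p.support, u ∈ q.support → u = b) :
    (p.append q).IsPath := by
  rw [Walk.isPath_def, Walk.support_append]
  have hq' := hq.support_nodup
  rw [← Walk.cons_tail_support] at hq'
  refine List.Nodup.append hp.support_nodup (List.nodup_cons.1 hq').2 ?_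
  intro u hu hu'
  have := h u hu (List.mem_of_mem_tail hu')
  subst this
  exact (List.nodup_cons.1 hq').1 hu'

/-- Two internally disjoint paths with the same endpoints form a cycle. -/
theorem cycleGraph_isContained_of_two_paths {a b : V} (p q : G.Walk a b) (hp : p.IsPath)
    (hq : q.IsPath) (h : ∀ u ∈ p.support, u ∈ q.support → u = a ∨ u = b) (hab : a ≠ b)
    (m : ℕ) (hm : p.length + q.length = m) : cycleGraph m ⊑ G := by
  cases q with
  | nil => exact absurd rfl hab
  | @cons _ c _ hac q =>
    rw [Walk.cons_isPath_iff] at hq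
    refine cycleGraph_isContained_of_isPath (p.append q.reverse) ?_ hac.symm m ?_
    · refine hp.append_of_inter hq.1.reverse ?_
      intro u hu hu'
      rw [Walk.support_reverse, List.mem_reverse] at hu'
      rcases h u hu (by simp [hu']) with rfl | h
      · exact absurd hu' hq.2
      · exact h
    · simp only [Walk.length_append, Walk.length_reverse, Walk.length_cons] at hm ⊢
      omega

/-- In a graph without short cycles, short paths are determined by their endpoints. -/
theorem Walk.IsPath.eq_of_cycleGraph_free {g : ℕ}
    (hg : ∀ m, 3 ≤ m → m ≤ g → (cycleGraph m).Free G) {a b : V} (p q : G.Walk a b)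
    (hp : p.IsPath) (hq : q.IsPath) (hpq : p.length + q.length ≤ g) : p = q := by
  classical
  induction hn : p.length + q.length using Nat.strong_induction_on generalizing a b with
  | _ n ih =>
    subst hn
    cases p with
    | nil =>
      have := Walk.isPath_iff_nil.1 hq
      exact this.eq_nil.symm
    | @cons _ c _ hac p =>
      cases q with
      | nil => exact absurd (Walk.isPath_iff_nil.1 hp) (by simp)
      | @cons _ d _ had q =>
        by_cases hcd : c = d
        · subst hcd
          have := ih (p.length + q.length) (by simp; omega) p q hp.of_cons hq.of_cons
            (by simp at hpq; omega) rfl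
          rw [this]
        · exfalso
          have hab : a ≠ b := by
            rintro rfl
            exact absurd (Walk.isPath_iff_nil.1 hp) (by simp)
          by_cases hu : ∀ u ∈ (Walk.cons hac p).support, u ∈ (Walk.cons had q).support →
              u = a ∨ u = b
          · refine hg _ ?_ hpq (cycleGraph_isContained_of_two_paths _ _ hp hq hu hab _ rfl)
            by_contra hlt
            simp only [Walk.length_cons] at hlt
            have h1 : p.length = 0 := by omega
            have h2 : q.length = 0 := by omega
            exact hcd ((Walk.eq_of_length_eq_zero h1).trans (Walk.eq_of_length_eq_zero h2).symm)
          · push Not at hu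
            obtain ⟨u, hup, huq, hua, hub⟩ := hu
            -- A further common vertex `u` cuts off shorter initial pieces; by induction these
            -- agree, which forces the same first step.
            have e := ih _ ?_ ((Walk.cons hac p).takeUntil u hup) ((Walk.cons had q).takeUntil u huq)
              (hp.takeUntil hup) (hq.takeUntil huq) ?_ rfl
            · have e' := congrArg Walk.snd e
              rw [Walk.snd_takeUntil hua, Walk.snd_takeUntil hua] at e'
              simp at e'
              exact hcd e'
            · exact Nat.add_lt_add (Walk.length_takeUntil_lt_length hup hub) (Walk.length_takeUntil_lt_length huq hub)
            · refine le_trans (Nat.add_le_add (Walk.length_takeUntil_le_length _ hup)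
                (Walk.length_takeUntil_le_length _ huq)) hpq

/-- The path of iterated parents. -/
theorem exists_isPath_iterate {π : V → V} {d : V → ℕ}
    (hπ : ∀ u, 0 < d u → G.Adj u (π u) ∧ d (π u) + 1 = d u) (h : ℕ) (x : V) (hx : h ≤ d x) :
    d (π^[h] x) + h = d x ∧ ∃ p : G.Walk x (π^[h] x), p.IsPath ∧ p.length = h ∧
      ∀ u ∈ p.support, ∃ t ≤ h, u = π^[t] x ∧ d u + t = d x := by
  induction h generalizing x with
  | zero => exact ⟨by simp, Walk.nil, by simp, by simp, by simp⟩
  | succ h ih =>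
    obtain ⟨hadj, hd⟩ := hπ x (by omega)
    obtain ⟨h1, p, hp, hl, hs⟩ := ih (π x) (by omega)
    rw [Function.iterate_succ_apply]
    refine ⟨by omega, Walk.cons hadj p, ?_, by simp [hl], ?_⟩
    · rw [Walk.cons_isPath_iff]
      refine ⟨hp, fun hmem => ?_⟩
      obtain ⟨t, ht, e, e'⟩ := hs x hmem
      omega
    · intro u hu
      rw [Walk.support_cons, List.mem_cons] at hu
      rcases hu with rfl | hu
      · exact ⟨0, by omega, rfl, rfl⟩
      · obtain ⟨t, ht, e, e'⟩ := hs u hu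
        exact ⟨t + 1, by omega, by rw [Function.iterate_succ_apply]; exact e, by omega⟩

end SimpleGraph

/-! ### Dense subrelations and branching in trees -/

open Classical in
/-- A dense bipartite relation has a subrelation of large minimum degree. -/
theorem exists_minDegree_subrelation {α β : Type*} (R : α → β → Prop) (D : ℕ) (X : Finset α)
    (Y : Finset β) (h : D * (X.card + Y.card) < ∑ y ∈ Y, (X.filter fun x => R x y).card) :
    ∃ X' ⊆ X, ∃ Y' ⊆ Y, X'.Nonempty ∧ (∀ x ∈ X', D < (Y'.filter fun y => R x y).card) ∧
      ∀ y ∈ Y', D < (X'.filter fun x => R x y).card := by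
  induction hn : X.card + Y.card generalizing X Y with
  | zero =>
    have : Y.card = 0 := by omega
    rw [Finset.card_eq_zero.1 this] at h
    simp at h
  | succ n ih =>
    have hswap : ∀ (X : Finset α) (Y : Finset β), ∑ y ∈ Y, (X.filter fun x => R x y).card =
        ∑ x ∈ X, (Y.filter fun y => R x y).card := fun X Y =>
      (Finset.sum_card_bipartiteAbove_eq_sum_card_bipartiteBelow R).symm
    by_cases hx : ∃ x ∈ X, (Y.filter fun y => R x y).card ≤ D
    · obtain ⟨x, hxX, hxD⟩ := hx
      have hc := Finset.card_erase_add_one hxX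
      have hs : ∑ y ∈ Y, (X.filter fun x => R x y).card ≤
          (∑ y ∈ Y, ((X.erase x).filter fun x => R x y).card) + D := by
        rw [hswap, hswap, ← Finset.sum_erase_add _ _ hxX]
        omega
      obtain ⟨X', hX', Y', hY', h1, h2, h3⟩ := ih (X.erase x) Y (by
        have : D * (X.card + Y.card) = D * ((X.erase x).card + Y.card) + D := by
          rw [← hc]; ring
        omega) (by omega)
      exact ⟨X', hX'.trans (Finset.erase_subset _ _), Y', hY', h1, h2, h3⟩
    · by_cases hy : ∃ y ∈ Y, (X.filter fun x => R x y).card ≤ D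
      · obtain ⟨y, hyY, hyD⟩ := hy
        have hc := Finset.card_erase_add_one hyY
        have hs : ∑ y ∈ Y, (X.filter fun x => R x y).card ≤
            (∑ y ∈ Y.erase y, (X.filter fun x => R x y).card) + D := by
          rw [← Finset.sum_erase_add _ _ hyY]
          omega
        obtain ⟨X', hX', Y', hY', h1, h2, h3⟩ := ih X (Y.erase y) (by
          have : D * (X.card + Y.card) = D * (X.card + (Y.erase y).card) + D := by
            rw [← hc]; ring
          omega) (by omega)
        exact ⟨X', hX', Y', hY'.trans (Finset.erase_subset _ _), h1, h2, h3⟩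
      · push Not at hx hy
        refine ⟨X, subset_rfl, Y, subset_rfl, ?_, hx, hy⟩
        rw [Finset.nonempty_iff_ne_empty]
        rintro rfl
        simp at h

open Classical in
/-- Descending in a tree of height `l` towards the majority child, one finds a positive proportion
of the leaves which have a common ancestor none of whose children has a majority. -/
theorem exists_balanced_subset {V W : Type*} (anc : ℕ → V → W) (l : ℕ) (L : Finset V)
    (h0 : ∃ z, ∀ x ∈ L, anc 0 x = z) (hl : Set.InjOn (anc l) L) :
    L.card ≤ 2 ^ l ∨ ∃ j < l, ∃ L' ⊆ L, (∃ z, ∀ x ∈ L', anc j x = z) ∧ L.card ≤ 2 ^ l * L'.card ∧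
      ∀ w, 2 * (L'.filter fun x => anc (j + 1) x = w).card ≤ L'.card := by
  have key : ∀ i ≤ l, (∃ j < i, ∃ L' ⊆ L, (∃ z, ∀ x ∈ L', anc j x = z) ∧
      L.card ≤ 2 ^ i * L'.card ∧ ∀ w, 2 * (L'.filter fun x => anc (j + 1) x = w).card ≤ L'.card) ∨
      ∃ L' ⊆ L, (∃ z, ∀ x ∈ L', anc i x = z) ∧ L.card ≤ 2 ^ i * L'.card := by
    intro i
    induction i with
    | zero => exact fun _ => Or.inr ⟨L, subset_rfl, h0, by simp⟩
    | succ i ih =>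
      intro hi
      rcases ih (by omega) with ⟨j, hj, L', hL', hz, hc, hb⟩ | ⟨L', hL', hz, hc⟩
      · exact Or.inl ⟨j, by omega, L', hL', hz, hc.trans (Nat.mul_le_mul_right _
          (Nat.pow_le_pow_right (by norm_num) (by omega))), hb⟩
      · by_cases hb : ∀ w, 2 * (L'.filter fun x => anc (i + 1) x = w).card ≤ L'.card
        · exact Or.inl ⟨i, by omega, L', hL', hz, hc.trans (Nat.mul_le_mul_right _
            (Nat.pow_le_pow_right (by norm_num) (by omega))), hb⟩
        · push Not at hb
          obtain ⟨w, hw⟩ := hb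
          refine Or.inr ⟨L'.filter fun x => anc (i + 1) x = w,
            (Finset.filter_subset _ _).trans hL', ⟨w, fun x hx => (Finset.mem_filter.1 hx).2⟩, ?_⟩
          calc L.card ≤ 2 ^ i * L'.card := hc
            _ ≤ 2 ^ i * (2 * (L'.filter fun x => anc (i + 1) x = w).card) :=
              Nat.mul_le_mul_left _ hw.le
            _ = _ := by ring
  rcases key l le_rfl with ⟨j, hj, h⟩ | ⟨L', hL', ⟨z, hz⟩, hc⟩
  · exact Or.inr ⟨j, hj, h⟩
  · left
    have : L'.card ≤ 1 := Finset.card_le_one.2 fun a ha b hb =>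
      hl (hL' ha) (hL' hb) ((hz a ha).trans (hz b hb).symm)
    calc L.card ≤ 2 ^ l * L'.card := hc
      _ ≤ 2 ^ l * 1 := Nat.mul_le_mul_left _ this
      _ = 2 ^ l := mul_one _

/-! ### Edges above a level of a breadth-first tree -/

namespace SimpleGraph

variable {V : Type*} {G : SimpleGraph V}

open Classical in
/-- Greedy construction of an alternating path in a bipartite relation of large minimum degree. -/
theorem exists_alternating_path {W : Type*} (R : V → V → Prop) (hR : ∀ x y, R x y → G.Adj x y)
    (zX zY : V → W) (hz : ∀ x y, R x y → zX x = zY y) (D : ℕ) (X Y : Finset V)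
    (hX : ∀ x ∈ X, D < (Y.filter fun y => R x y).card)
    (hY : ∀ y ∈ Y, D < (X.filter fun x => R x y).card) (x₀ : V) (hx₀ : x₀ ∈ X) (s : ℕ)
    (hs : 2 * s + 1 ≤ D) :
    ∃ y ∈ Y, zX x₀ = zY y ∧ ∃ p : G.Walk x₀ y, p.IsPath ∧ p.length = 2 * s + 1 ∧
      ∀ u ∈ p.support, u ∈ X ∨ u ∈ Y := by
  -- Every degree exceeds `D`, hence exceeds the number of vertices of any path to be extended.
  have fresh : ∀ {u : V} (p : G.Walk x₀ u) (S : Finset V), p.length + 1 < S.card →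
      ∃ w ∈ S, w ∉ p.support := by
    intro u p S hS
    by_contra hcon
    push Not at hcon
    have h1 : S ⊆ p.support.toFinset := fun w hw => List.mem_toFinset.2 (hcon w hw)
    have h2 := (Finset.card_le_card h1).trans p.support.toFinset_card_le
    rw [Walk.length_support] at h2
    omega
  have odd_of_even : ∀ s, 2 * s + 1 ≤ D → (∃ x ∈ X, zX x₀ = zX x ∧ ∃ p : G.Walk x₀ x,
      p.IsPath ∧ p.length = 2 * s ∧ ∀ u ∈ p.support, u ∈ X ∨ u ∈ Y) →
      ∃ y ∈ Y, zX x₀ = zY y ∧ ∃ p : G.Walk x₀ y, p.IsPath ∧ p.length = 2 * s + 1 ∧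
      ∀ u ∈ p.support, u ∈ X ∨ u ∈ Y := by
    rintro s hs ⟨x, hx, hzx, p, hp, hl, hsup⟩
    obtain ⟨y, hy, hyp⟩ := fresh p _ (lt_of_le_of_lt (by omega) (hX x hx))
    rw [Finset.mem_filter] at hy
    refine ⟨y, hy.1, hzx.trans (hz x y hy.2), p.concat (hR x y hy.2), hp.concat hyp _, by simp [hl],
      ?_⟩
    intro u hu
    rw [Walk.support_concat, List.mem_append, List.mem_singleton] at hu
    rcases hu with hu | rfl
    · exact hsup u hu
    · exact Or.inr hy.1
  refine odd_of_even s hs ?_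
  induction s with
  | zero => exact ⟨x₀, hx₀, rfl, Walk.nil, by simp, by simp, by simp [hx₀]⟩
  | succ s ih =>
    obtain ⟨y, hy, hzy, p, hp, hl, hsup⟩ := odd_of_even s (by omega) (ih (by omega))
    obtain ⟨x, hx, hxp⟩ := fresh p _ (lt_of_le_of_lt (by omega) (hY y hy))
    rw [Finset.mem_filter] at hx
    refine ⟨x, hx.1, hzy.trans (hz x y hx.2).symm, p.concat (hR x y hx.2).symm, hp.concat hxp _,
      by simp [hl]; ring, ?_⟩
    intro u hu
    rw [Walk.support_concat, List.mem_append, List.mem_singleton] at hu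
    rcases hu with hu | rfl
    · exact hsup u hu
    · exact Or.inl hx.1

/-- The parent is the next vertex on a shortest walk back to `v`. Unreachable vertices have `dist`
zero, so like the root they get an arbitrary value. -/
theorem exists_parent (v : V) : ∃ π : V → V, ∀ u, 0 < G.dist v u →
    G.Adj u (π u) ∧ G.dist v (π u) + 1 = G.dist v u := by
  have : ∀ u, ∃ w, 0 < G.dist v u → G.Adj u w ∧ G.dist v w + 1 = G.dist v u := by
    intro u
    by_cases hu : 0 < G.dist v u
    · obtain ⟨p, hp⟩ := exists_walk_of_dist_ne_zero (by rw [dist_comm]; exact hu.ne' :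
        G.dist u v ≠ 0)
      rw [dist_comm] at hp
      cases p with
      | nil => simp at hu
      | @cons _ w _ h p =>
        refine ⟨w, fun _ => ⟨h, ?_⟩⟩
        rw [Walk.length_cons] at hp
        have h1 : G.dist v w ≤ p.length := by rw [dist_comm]; exact dist_le p
        have hr : G.Reachable v w := ⟨p.reverse⟩
        obtain ⟨q, hq⟩ := hr.exists_walk_length_eq_dist
        have h2 := dist_le (q.concat h.symm)
        rw [Walk.length_concat] at h2
        omega
    · exact ⟨u, fun h => absurd h hu⟩
  choose π hπ using this
  exact ⟨π, hπ⟩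

open Classical in
/-- The balanced case of the counting of edges above a level of a breadth-first search tree. -/
theorem sum_card_balanced_le {k l j : ℕ} (hkl : l < k) (hj : j < l)
    (hG : (cycleGraph (2 * k)).Free G) {v : V} {π : V → V} (hπ : ∀ u, 0 < G.dist v u →
    G.Adj u (π u) ∧ G.dist v (π u) + 1 = G.dist v u) (X Y : Finset V)
    (hX : ∀ x ∈ X, G.dist v x = l) (hY : ∀ y ∈ Y, l ≤ G.dist v y) (L : V → Finset V)
    (hLX : ∀ y ∈ Y, L y ⊆ X) (hadj : ∀ y ∈ Y, ∀ x ∈ L y, G.Adj x y)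
    (hz : ∀ y ∈ Y, ∃ z, ∀ x ∈ L y, π^[l - j] x = z)
    (hb : ∀ y ∈ Y, ∀ w, 2 * ((L y).filter fun x => π^[l - (j + 1)] x = w).card ≤ (L y).card) :
    ∑ y ∈ Y, (L y).card ≤ 4 * k * (X.card + Y.card) := by
  by_contra hcon
  push Not at hcon
  have hz' : ∀ y, ∃ z, y ∈ Y → ∀ x ∈ L y, π^[l - j] x = z := by
    intro y
    by_cases hy : y ∈ Y
    · obtain ⟨z, hz⟩ := hz y hy
      exact ⟨z, fun _ => hz⟩
    · exact ⟨y, fun h => absurd h hy⟩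
  choose z hz using hz'
  obtain ⟨R, hR⟩ : ∃ R : V → V → Prop, ∀ x y, R x y ↔ y ∈ Y ∧ x ∈ L y := ⟨_, fun _ _ => Iff.rfl⟩
  obtain ⟨X', hX', Y', hY', ⟨x₀, hx₀⟩, h1, h2⟩ :=
    exists_minDegree_subrelation R (4 * k) X Y (by
      refine lt_of_lt_of_le hcon (Finset.sum_le_sum fun y hy => Finset.card_le_card ?_)
      intro x hx
      exact Finset.mem_filter.2 ⟨hLX y hy hx, (hR x y).2 ⟨hy, hx⟩⟩)
  -- The length is chosen so that path, one closing edge and two tree paths of length `l - j` add up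
  -- to 2k. The common ancestor is constant along related pairs, so `x₀` and the neighbours of the
  -- last vertex share it.
  obtain ⟨y, hy, hzy, p, hp, hl, hsup⟩ := exists_alternating_path (G := G)
    R (fun x y h => hadj y ((hR x y).1 h).1 x ((hR x y).1 h).2) (fun x => π^[l - j] x) z
    (fun x y h => hz y ((hR x y).1 h).1 x ((hR x y).1 h).2) (4 * k) X' Y' h1 h2 x₀ hx₀
    (k - l + j - 1) (by omega)
  have hyY := hY' hy
  have hLy : 4 * k < (L y).card := lt_of_lt_of_le (h2 y hy) (Finset.card_le_card fun x hx =>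
    ((hR x y).1 (Finset.mem_filter.1 hx).2).2)
  -- At most half of `L y` lies below the child leading to `x₀`, and the path has fewer than 2k
  -- vertices; as `L y` has more than 4k elements, some element avoids both.
  obtain ⟨x₁, hx₁, hne, hx₁p⟩ : ∃ x₁ ∈ L y, π^[l - (j + 1)] x₁ ≠ π^[l - (j + 1)] x₀ ∧
      x₁ ∉ p.support := by
    by_contra hc
    push Not at hc
    have hsub : L y ⊆ ((L y).filter fun x => π^[l - (j + 1)] x = π^[l - (j + 1)] x₀) ∪
        p.support.toFinset := by
      intro x hx
      rw [Finset.mem_union, Finset.mem_filter, List.mem_toFinset]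
      by_cases he : π^[l - (j + 1)] x = π^[l - (j + 1)] x₀
      · exact Or.inl ⟨hx, he⟩
      · exact Or.inr (hc x hx he)
    have c1 := (Finset.card_le_card hsub).trans (Finset.card_union_le _ _)
    have c2 := p.support.toFinset_card_le
    rw [Walk.length_support, hl] at c2
    have c3 := hb y hyY (π^[l - (j + 1)] x₀)
    omega
  have hd₀ : G.dist v x₀ = l := hX x₀ (hX' hx₀)
  have hd₁ : G.dist v x₁ = l := hX x₁ (hLX y hyY hx₁)
  have hup : ∀ u ∈ (p.concat (hadj y hyY x₁ hx₁).symm).support, l ≤ G.dist v u := by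
    intro u hu
    rw [Walk.support_concat, List.mem_append, List.mem_singleton] at hu
    rcases hu with hu | rfl
    · rcases hsup u hu with h | h
      · exact (hX u (hX' h)).ge
      · exact hY u (hY' h)
    · exact hd₁.ge
  obtain ⟨-, q₀, hq₀, hql₀, hqs₀⟩ := exists_isPath_iterate hπ (l - j) x₀ (by omega)
  obtain ⟨-, q₁, hq₁, hql₁, hqs₁⟩ := exists_isPath_iterate hπ (l - j) x₁ (by omega)
  have hzz : π^[l - j] x₁ = π^[l - j] x₀ := (hz y hyY x₁ hx₁).trans hzy.symm
  have hcat : (q₀.append (q₁.reverse.copy hzz rfl)).IsPath := by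
    refine hq₀.append_of_inter ((Walk.isPath_copy _ _ _).2 hq₁.reverse) ?_
    intro u hu hu'
    rw [Walk.support_copy, Walk.support_reverse, List.mem_reverse] at hu'
    obtain ⟨t, ht, e, e'⟩ := hqs₀ u hu
    obtain ⟨t', ht', f, f'⟩ := hqs₁ u hu'
    have htt : t' = t := by omega
    subst htt
    -- Tree paths meeting before the common ancestor would enter it through the same child, against
    -- the choice of `x₁`.
    rcases Nat.lt_or_ge t' (l - j) with hlt | hge
    · exfalso
      apply hne
      have : l - (j + 1) = (l - (j + 1) - t') + t' := by omega
      rw [this, Function.iterate_add_apply, Function.iterate_add_apply, ← e, ← f]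
    · have : t' = l - j := by omega
      rw [e, this]
  -- The alternating path stays at distance at least `l` from `v`, while the tree paths lie strictly
  -- below level `l` apart from `x₀` and `x₁`.
  refine hG (cycleGraph_isContained_of_two_paths (p.concat (hadj y hyY x₁ hx₁).symm)
    (q₀.append (q₁.reverse.copy hzz rfl)) (hp.concat hx₁p _) hcat ?_ ?_ (2 * k) ?_)
  · intro u hu hu'
    have hle := hup u hu
    rw [Walk.mem_support_append_iff, Walk.support_copy, Walk.support_reverse,
      List.mem_reverse] at hu'
    rcases hu' with hu' | hu'
    · obtain ⟨t, ht, e, e'⟩ := hqs₀ u hu'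
      have : t = 0 := by omega
      subst this
      exact Or.inl e
    · obtain ⟨t, ht, e, e'⟩ := hqs₁ u hu'
      have : t = 0 := by omega
      subst this
      exact Or.inr e
  · rintro rfl
    exact hne rfl
  · rw [Walk.length_concat, Walk.length_append, Walk.length_copy, Walk.length_reverse, hl, hql₀,
      hql₁]
    omega

open Classical in
/-- In a graph without `C_{2k}`, only linearly many edges join the `l`-th level around a vertex to
vertices at distance at least `l`, for `l < k`. -/
theorem sum_card_adj_level_le {k l : ℕ} (hl : 0 < l) (hkl : l < k) (hG : (cycleGraph (2 * k)).Free G) {v : V}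
    (X Y : Finset V) (hX : ∀ x ∈ X, G.dist v x = l) (hY : ∀ y ∈ Y, l ≤ G.dist v y) :
    ∑ y ∈ Y, (X.filter fun x => G.Adj x y).card ≤
      2 ^ l * (1 + 4 * k * l) * (X.card + Y.card) := by
  obtain ⟨π, hπ⟩ := exists_parent (G := G) v
  have hroot : ∀ x ∈ X, π^[l] x = v := by
    intro x hx
    have hdx := hX x hx
    obtain ⟨h1, p, -, -, -⟩ := exists_isPath_iterate hπ l x hdx.ge
    -- Distance zero alone could also mean unreachable, so reachability is needed to identify the
    -- ancestor with `v`.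
    have hr : G.Reachable v x := Reachable.of_dist_ne_zero (by omega)
    exact (((hr.trans ⟨p⟩).dist_eq_zero_iff).1 (by omega)).symm
  have hdich : ∀ y, ∃ (j : ℕ) (L' : Finset V), y ∈ Y →
      (X.filter fun x => G.Adj x y).card ≤ 2 ^ l ∨ (j < l ∧ L' ⊆ (X.filter fun x => G.Adj x y) ∧
      (∃ z, ∀ x ∈ L', π^[l - j] x = z) ∧
      (X.filter fun x => G.Adj x y).card ≤ 2 ^ l * L'.card ∧
      ∀ w, 2 * (L'.filter fun x => π^[l - (j + 1)] x = w).card ≤ L'.card) := by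
    intro y
    rcases exists_balanced_subset (fun j x => π^[l - j] x) l (X.filter fun x => G.Adj x y)
      ⟨v, fun x hx => hroot x (Finset.mem_filter.1 hx).1⟩ (by
        intro a _ b _ h
        simpa using h) with h | ⟨j, hj, L', h⟩
    · exact ⟨0, ∅, fun _ => Or.inl h⟩
    · exact ⟨j, L', fun _ => Or.inr ⟨hj, h⟩⟩
  choose j L' hjL using hdich
  set S := Y.filter fun y => 2 ^ l < (X.filter fun x => G.Adj x y).card with hS
  have hSY : ∀ y ∈ S, y ∈ Y ∧ j y < l ∧ L' y ⊆ (X.filter fun x => G.Adj x y) ∧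
      (∃ z, ∀ x ∈ L' y, π^[l - j y] x = z) ∧
      (X.filter fun x => G.Adj x y).card ≤ 2 ^ l * (L' y).card ∧
      ∀ w, 2 * ((L' y).filter fun x => π^[l - (j y + 1)] x = w).card ≤ (L' y).card := by
    intro y hy
    rw [hS, Finset.mem_filter] at hy
    rcases hjL y hy.1 with h | h
    · omega
    · exact ⟨hy.1, h⟩
  have hpoint : ∀ y ∈ Y, (X.filter fun x => G.Adj x y).card ≤
      2 ^ l + if y ∈ S then 2 ^ l * (L' y).card else 0 := by
    intro y hy
    split_ifs with h
    · exact (hSY y h).2.2.2.2.1.trans (Nat.le_add_left _ _)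
    · rw [hS, Finset.mem_filter] at h
      simp only [hy, true_and, not_lt] at h
      simpa using h
  -- Sorting by the depth of the branching ancestor gives `l` classes, each covered by the balanced
  -- case.
  have hbal : ∑ y ∈ S, (L' y).card ≤ l * (4 * k * (X.card + Y.card)) := by
    rw [← Finset.sum_fiberwise_of_maps_to (s := S) (t := Finset.range l) (g := j)
      (fun y hy => Finset.mem_range.2 (hSY y hy).2.1)]
    refine (Finset.sum_le_card_nsmul _ _ (4 * k * (X.card + Y.card)) ?_).trans (by simp)
    intro i hi
    have hi' := Finset.mem_range.1 hi
    have hmem : ∀ y ∈ S.filter fun y => j y = i, y ∈ S ∧ j y = i := fun y hy =>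
      Finset.mem_filter.1 hy
    refine (sum_card_balanced_le hkl hi' hG hπ X _ hX (fun y hy => hY y (hSY y (hmem y hy).1).1) L'
      (fun y hy => (hSY y (hmem y hy).1).2.2.1.trans (Finset.filter_subset _ _))
      (fun y hy x hx => (Finset.mem_filter.1 ((hSY y (hmem y hy).1).2.2.1 hx)).2)
      (fun y hy => ?_) (fun y hy => ?_)).trans ?_
    · rw [← (hmem y hy).2]
      exact (hSY y (hmem y hy).1).2.2.2.1
    · rw [← (hmem y hy).2]
      exact (hSY y (hmem y hy).1).2.2.2.2.2
    · exact Nat.mul_le_mul_left _ (Nat.add_le_add_left (Finset.card_le_card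
        ((Finset.filter_subset _ _).trans (Finset.filter_subset _ _))) _)
  calc ∑ y ∈ Y, (X.filter fun x => G.Adj x y).card
      ≤ ∑ y ∈ Y, (2 ^ l + if y ∈ S then 2 ^ l * (L' y).card else 0) := Finset.sum_le_sum hpoint
    _ = Y.card * 2 ^ l + 2 ^ l * ∑ y ∈ S, (L' y).card := by
        rw [Finset.sum_add_distrib, Finset.sum_const, smul_eq_mul, ← Finset.sum_filter,
          Finset.filter_mem_eq_inter, Finset.inter_eq_right.2 (Finset.filter_subset _ _),
          Finset.mul_sum]
    _ ≤ (X.card + Y.card) * 2 ^ l + 2 ^ l * (l * (4 * k * (X.card + Y.card))) :=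
        Nat.add_le_add (Nat.mul_le_mul_right _ (Nat.le_add_left _ _)) (Nat.mul_le_mul_left _ hbal)
    _ = 2 ^ l * (1 + 4 * k * l) * (X.card + Y.card) := by ring

end SimpleGraph

/-! ### Labelled cycles in graphs without short cycles -/

namespace SimpleGraph

variable {V : Type*}

section

variable {G : SimpleGraph V}

/-- A shortest path is no longer than `p`, so uniqueness of short paths identifies the two. -/
theorem dist_eq_length_of_isPath {g : ℕ} (hg : ∀ m, 3 ≤ m → m ≤ g → (cycleGraph m).Free G)
    {v u : V} (p : G.Walk v u) (hp : p.IsPath) (h : 2 * p.length ≤ g) :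
    G.dist v u = p.length := by
  obtain ⟨r, hr, hrl⟩ := Reachable.exists_path_of_dist (⟨p⟩ : G.Reachable v u)
  have := dist_le p
  rw [← hrl, Walk.IsPath.eq_of_cycleGraph_free hg r p hr hp (by omega)]

/-- A path returning to `x` would compete with the edge between `v` and `x`; by uniqueness its first
step would already be `x`. -/
theorem notMem_support_of_snd_ne {g : ℕ} (hg : ∀ m, 3 ≤ m → m ≤ g → (cycleGraph m).Free G)
    {x v u : V} (hxv : G.Adj x v) (p : G.Walk v u) (hp : p.IsPath) (h : p.length + 1 ≤ g)
    (hx : p.getVert 1 ≠ x) : x ∉ p.support := by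
  classical
  intro hmem
  have hle := Walk.length_takeUntil_le_length p hmem
  have e := Walk.IsPath.eq_of_cycleGraph_free hg (p.takeUntil x hmem) hxv.symm.toWalk
    (hp.takeUntil hmem) (Walk.IsPath.of_adj _) (by simp; omega)
  have e' := congrArg Walk.snd e
  rw [Walk.snd_takeUntil hxv.ne] at e'
  exact hx (by simpa using e')

/-- A labelled cycle of length `N`. -/
def IsLabelledCycle (G : SimpleGraph V) (N : ℕ) (f : ZMod N → V) : Prop :=
  Function.Injective f ∧ ∀ i, G.Adj (f i) (f (i + 1))

namespace IsLabelledCycle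

variable {N : ℕ} {f f' : ZMod N → V}

theorem comp_neg (h : G.IsLabelledCycle N f) : G.IsLabelledCycle N fun i => f (-i) := by
  refine ⟨h.1.comp neg_injective, fun i => ?_⟩
  have := h.2 (-(i + 1))
  rw [show -(i + 1) + 1 = -i by ring] at this
  exact this.symm

theorem comp_add (h : G.IsLabelledCycle N f) (c : ZMod N) :
    G.IsLabelledCycle N fun i => f (i + c) := by
  refine ⟨h.1.comp (add_left_injective c), fun i => ?_⟩
  have := h.2 (i + c)
  rwa [show i + c + 1 = i + 1 + c by ring] at this

theorem exists_isPath (h : G.IsLabelledCycle N f) (a : ZMod N) (m : ℕ) (hm : m < N) :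
    ∃ p : G.Walk (f a) (f (a + m)), p.IsPath ∧ p.length = m ∧
      (∀ t ≤ m, p.getVert t = f (a + t)) := by
  have key : ∃ p : G.Walk (f a) (f (a + m)), p.IsPath ∧ p.length = m ∧
      (∀ t ≤ m, p.getVert t = f (a + t)) ∧ ∀ u ∈ p.support, ∃ t ≤ m, u = f (a + (t : ℕ)) := by
    induction m with
    | zero => exact ⟨Walk.nil.copy rfl (by simp), by simp, by simp, by simp, by simp⟩
    | succ m ih =>
      obtain ⟨p, hp, hl, hv, hs⟩ := ih (by omega)
      have hadj : G.Adj (f (a + m)) (f (a + (m + 1 : ℕ))) := by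
        have := h.2 (a + m)
        rwa [add_assoc, ← Nat.cast_succ] at this
      have hnew : f (a + (m + 1 : ℕ)) ∉ p.support := by
        intro hmem
        obtain ⟨t, ht, e⟩ := hs _ hmem
        have e' := add_left_cancel (h.1 e)
        rw [ZMod.natCast_eq_natCast_iff'] at e'
        rw [Nat.mod_eq_of_lt hm, Nat.mod_eq_of_lt (by omega)] at e'
        omega
      refine ⟨p.concat hadj, hp.concat hnew hadj, by simp [hl], ?_, ?_⟩
      · intro t ht
        rcases Nat.lt_or_ge m t with h1 | h1
        · have : t = (p.concat hadj).length := by simp [hl]; omega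
          rw [this, Walk.getVert_length]
          simp [hl]
        · rw [Walk.concat_eq_append, Walk.getVert_append]
          split_ifs with h2
          · exact hv t h1
          · have : t = m := by omega
            subst this
            simp [hl]
      · intro u hu
        rw [Walk.support_concat, List.mem_append, List.mem_singleton] at hu
        rcases hu with hu | rfl
        · obtain ⟨t, ht, e⟩ := hs u hu
          exact ⟨t, by omega, e⟩
        · exact ⟨m + 1, le_rfl, rfl⟩
  obtain ⟨p, h1, h2, h3, -⟩ := key
  exact ⟨p, h1, h2, h3⟩

theorem eq_on_segment {g : ℕ} (hg : ∀ m, 3 ≤ m → m ≤ g → (cycleGraph m).Free G)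
    (h : G.IsLabelledCycle N f) (h' : G.IsLabelledCycle N f') (a b : ZMod N) (m : ℕ) (hm : m < N)
    (hmg : 2 * m ≤ g) (hb : a + m = b) (h0 : f a = f' a) (h1 : f b = f' b) (t : ℕ) (ht : t ≤ m) :
    f (a + t) = f' (a + t) := by
  subst hb
  obtain ⟨p, hp, hl, hv⟩ := h.exists_isPath a m hm
  obtain ⟨p', hp', hl', hv'⟩ := h'.exists_isPath a m hm
  have e := Walk.IsPath.eq_of_cycleGraph_free hg p (p'.copy h0.symm h1.symm) hp
    ((Walk.isPath_copy _ _ _).2 hp') (by simp; omega)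
  rw [← hv t ht, e, Walk.getVert_copy, hv' t ht]

/-- The base point and the opposite edge leave two arcs of length `l`, each determined by its ends
because two such arcs have total length only 2l. -/
theorem ext_of_antipodal {l : ℕ} {f f' : ZMod (2 * l + 1) → V}
    (hg : ∀ m, 3 ≤ m → m ≤ 2 * l → (cycleGraph m).Free G)
    (h : G.IsLabelledCycle (2 * l + 1) f) (h' : G.IsLabelledCycle (2 * l + 1) f') (h0 : f 0 = f' 0)
    (h1 : f l = f' l) (h2 : f (l + 1) = f' (l + 1)) : f = f' := by
  have hN : ((2 * l + 1 : ℕ) : ZMod (2 * l + 1)) = 0 := ZMod.natCast_self _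
  push_cast at hN
  funext i
  have hi := ZMod.val_lt i
  rcases Nat.lt_or_ge l i.val with hlt | hge
  · have := eq_on_segment hg h h' (l + 1) 0 l (by omega) le_rfl
      (by linear_combination hN) h2 h0 (i.val - (l + 1)) (by omega)
    have e : (l + 1 : ZMod (2 * l + 1)) + (i.val - (l + 1) : ℕ) = i := by
      rw [Nat.cast_sub (by omega)]
      push_cast
      rw [ZMod.natCast_zmod_val]
      ring
    rwa [e] at this
  · have := eq_on_segment hg h h' 0 l l (by omega) le_rfl (by simp) h0 h1 i.val hge
    rwa [zero_add, ZMod.natCast_zmod_val] at this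

theorem of_copy {N : ℕ} [NeZero N] (hN : 2 ≤ N) (φ : Copy (cycleGraph N) G) :
    G.IsLabelledCycle N fun i => φ.toHom ⟨i.val, ZMod.val_lt i⟩ := by
  refine ⟨fun i j h => ?_, fun i => ?_⟩
  · have h' : (⟨i.val, ZMod.val_lt i⟩ : Fin N) = ⟨j.val, ZMod.val_lt j⟩ := φ.injective h
    exact ZMod.val_injective _ (congrArg Fin.val h')
  · refine φ.toHom.map_adj (cycleGraph_adj'.2 (Or.inr ?_))
    have hi := ZMod.val_lt i
    have h1 : (1 : ZMod N).val = 1 := by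
      have := ZMod.val_natCast_of_lt (show 1 < N by omega)
      simpa using this
    rw [Fin.val_sub]
    simp only [ZMod.val_add, h1]
    rcases Nat.lt_or_ge (i.val + 1) N with hlt | hge
    · rw [Nat.mod_eq_of_lt hlt, show N - i.val + (i.val + 1) = 1 + N by omega,
        Nat.add_mod_right, Nat.mod_eq_of_lt (by omega)]
    · rw [show i.val + 1 = N by omega, Nat.mod_self, Nat.mod_eq_of_lt (by omega)]
      omega

end IsLabelledCycle

theorem cycleGraph_isContained_iff_isLabelledCycle {N : ℕ} (hN : 3 ≤ N) :
    cycleGraph N ⊑ G ↔ ∃ f, G.IsLabelledCycle N f := by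
  have : NeZero N := ⟨by omega⟩
  refine ⟨fun ⟨φ⟩ => ⟨_, .of_copy (by omega) φ⟩, fun ⟨f, hf⟩ => ?_⟩
  obtain ⟨p, hp, hl, -⟩ := hf.exists_isPath 0 (N - 1) (by omega)
  refine cycleGraph_isContained_of_isPath p hp ?_ N (by omega)
  have := hf.2 (0 + (N - 1 : ℕ))
  rw [add_assoc, ← Nat.cast_succ, show (N - 1).succ = N by omega, ZMod.natCast_self] at this
  simpa using this

end

/-! ### Counting non-backtracking walks -/

variable [Fintype V]

open Classical in
/-- The number of non-backtracking walks of length `m` which continue the arc from `x` to `v`. -/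
noncomputable def nonBacktrackingCount (G : SimpleGraph V) : ℕ → V → V → ℕ
  | 0, _, _ => 1
  | m + 1, x, v => ∑ w with G.Adj v w ∧ w ≠ x, nonBacktrackingCount G m v w

variable {G : SimpleGraph V}

/-- A walk may be cut anywhere, since its continuations depend only on its last arc; each block of
length `b` then contributes a factor. The companion upper bound is the same argument. -/
theorem pow_le_nonBacktrackingCount {b Q : ℕ}
    (h : ∀ x v, G.Adj x v → Q ≤ G.nonBacktrackingCount b x v) (j : ℕ) {x v : V}
    (hxv : G.Adj x v) : Q ^ j ≤ G.nonBacktrackingCount (b * j) x v := by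
  classical
  have key : ∀ (a c : ℕ), (∀ x v, G.Adj x v → c ≤ G.nonBacktrackingCount a x v) → ∀ b x v,
      G.Adj x v → G.nonBacktrackingCount b x v * c ≤ G.nonBacktrackingCount (a + b) x v := by
    intro a c hc b
    induction b with
    | zero => intro x v hxv; simpa [nonBacktrackingCount] using hc x v hxv
    | succ b ih =>
      intro x v hxv
      rw [← add_assoc, nonBacktrackingCount, nonBacktrackingCount, Finset.sum_mul]
      exact Finset.sum_le_sum fun w hw => ih v w (Finset.mem_filter.1 hw).2.1
  induction j generalizing x v with
  | zero => simp [nonBacktrackingCount]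
  | succ j ih =>
    rw [Nat.mul_succ, pow_succ, mul_comm]
    exact (Nat.mul_le_mul_right _ (h x v hxv)).trans (key _ _ (fun x v h => ih h) b x v hxv)

theorem nonBacktrackingCount_le_pow {b B : ℕ}
    (h : ∀ x v, G.Adj x v → G.nonBacktrackingCount b x v ≤ B) (j : ℕ) {x v : V}
    (hxv : G.Adj x v) : G.nonBacktrackingCount (b * j) x v ≤ B ^ j := by
  classical
  have key : ∀ (a c : ℕ), (∀ x v, G.Adj x v → G.nonBacktrackingCount a x v ≤ c) → ∀ b x v,
      G.Adj x v → G.nonBacktrackingCount (a + b) x v ≤ G.nonBacktrackingCount b x v * c := by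
    intro a c hc b
    induction b with
    | zero => intro x v hxv; simpa [nonBacktrackingCount] using hc x v hxv
    | succ b ih =>
      intro x v hxv
      rw [← add_assoc, nonBacktrackingCount, nonBacktrackingCount, Finset.sum_mul]
      exact Finset.sum_le_sum fun w hw => ih v w (Finset.mem_filter.1 hw).2.1
  induction j generalizing x v with
  | zero => simp [nonBacktrackingCount]
  | succ j ih =>
    rw [Nat.mul_succ, pow_succ, mul_comm (B ^ j)]
    exact (key _ _ (fun x v h => ih h) b x v hxv).trans (Nat.mul_le_mul_right _ (h x v hxv))

open Classical in
/-- The endpoints of the paths of length `m` which start in `v` and avoid `x`. -/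
noncomputable def pathEnds (G : SimpleGraph V) (m : ℕ) (x v : V) : Finset V :=
  {u | ∃ p : G.Walk v u, p.IsPath ∧ x ∉ p.support ∧ p.length = m}

theorem mem_pathEnds {m : ℕ} {x v u : V} : u ∈ G.pathEnds m x v ↔
    ∃ p : G.Walk v u, p.IsPath ∧ x ∉ p.support ∧ p.length = m := by
  simp [pathEnds]

theorem card_pathEnds_le (m : ℕ) (x v : V) :
    (G.pathEnds m x v).card ≤ G.nonBacktrackingCount m x v := by
  classical
  induction m generalizing x v with
  | zero =>
    rw [nonBacktrackingCount, Finset.card_le_one]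
    have : ∀ u ∈ G.pathEnds 0 x v, v = u := fun u hu => by
      obtain ⟨p, -, -, h⟩ := mem_pathEnds.1 hu
      exact Walk.eq_of_length_eq_zero h
    intro a ha b hb
    rw [← this a ha, ← this b hb]
  | succ m ih =>
    rw [nonBacktrackingCount]
    have hsub : G.pathEnds (m + 1) x v ⊆
        ({w | G.Adj v w ∧ w ≠ x} : Finset V).biUnion fun w => G.pathEnds m v w := by
      intro u hu
      obtain ⟨p, hp, hx, hl⟩ := mem_pathEnds.1 hu
      cases p with
      | nil => simp at hl
      | @cons _ w _ h p =>
        rw [Walk.cons_isPath_iff] at hp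
        rw [Finset.mem_biUnion]
        refine ⟨w, Finset.mem_filter.2 ⟨Finset.mem_univ _, h, ?_⟩, mem_pathEnds.2
          ⟨p, hp.1, hp.2, by simpa using hl⟩⟩
        rintro rfl
        simp at hx
    exact (Finset.card_le_card hsub).trans (Finset.card_biUnion_le.trans
      (Finset.sum_le_sum fun w _ => ih v w))

open Classical in
/-- The final arcs of the paths of length `m + 1` which start in `v` and avoid `x`. -/
noncomputable def pathArcs (G : SimpleGraph V) (m : ℕ) (x v : V) : Finset (V × V) :=
  {a | ∃ p : G.Walk v a.1, p.IsPath ∧ x ∉ p.support ∧ p.length = m ∧ G.Adj a.1 a.2 ∧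
    a.2 ∉ p.support ∧ a.2 ≠ x}

theorem mem_pathArcs {m : ℕ} {x v : V} {a : V × V} : a ∈ G.pathArcs m x v ↔
    ∃ p : G.Walk v a.1, p.IsPath ∧ x ∉ p.support ∧ p.length = m ∧ G.Adj a.1 a.2 ∧
      a.2 ∉ p.support ∧ a.2 ≠ x := by
  simp [pathArcs]

/-- Without short cycles these walks are paths avoiding `x`. The first `m` steps are determined by
their ends, so only the final arc need be remembered, and 2m ≤ g is enough. -/
theorem nonBacktrackingCount_le_card_pathArcs {g : ℕ}
    (hg : ∀ m, 3 ≤ m → m ≤ g → (cycleGraph m).Free G) (m : ℕ) (hm : 2 * m ≤ g) (hm' : m + 2 ≤ g)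
    {x v : V} (hxv : G.Adj x v) :
    G.nonBacktrackingCount (m + 1) x v ≤ (G.pathArcs m x v).card := by
  classical
  induction m generalizing x v with
  | zero =>
    simp only [nonBacktrackingCount, Finset.sum_const, smul_eq_mul, mul_one]
    refine Finset.card_le_card_of_injOn (fun w => (v, w)) ?_ (by intro a _ b _ h; simpa using h)
    intro w hw
    obtain ⟨-, h1, h2⟩ := Finset.mem_filter.1 hw
    exact mem_pathArcs.2 ⟨Walk.nil, by simp, by simpa using hxv.ne, rfl, h1,
      by simpa using h1.ne', h2⟩
  | succ m ih =>
    rw [nonBacktrackingCount]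
    calc _ ≤ ∑ w with G.Adj v w ∧ w ≠ x, (G.pathArcs m v w).card :=
          Finset.sum_le_sum fun w hw => ih (by omega) (by omega) (Finset.mem_filter.1 hw).2.1
      _ = (({w | G.Adj v w ∧ w ≠ x} : Finset V).biUnion fun w => G.pathArcs m v w).card := by
          refine (Finset.card_biUnion ?_).symm
          intro w hw w' hw' hne
          rw [Function.onFun, Finset.disjoint_left]
          intro a ha ha'
          obtain ⟨p, hp, hvp, hpl, -⟩ := mem_pathArcs.1 ha
          obtain ⟨q, hq, hvq, hql, -⟩ := mem_pathArcs.1 ha'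
          have e := Walk.IsPath.eq_of_cycleGraph_free hg
            (Walk.cons (Finset.mem_filter.1 hw).2.1 p) (Walk.cons (Finset.mem_filter.1 hw').2.1 q)
            (hp.cons hvp) (hq.cons hvq) (by simp; omega)
          have e' := congrArg Walk.snd e
          simp at e'
          exact hne e'
      _ ≤ _ := by
          refine Finset.card_le_card (Finset.biUnion_subset.2 fun w hw a ha => ?_)
          obtain ⟨-, hvw, hwx⟩ := Finset.mem_filter.1 hw
          obtain ⟨p, hp, hvp, hpl, hadj, hap, hav⟩ := mem_pathArcs.1 ha
          have hP : (Walk.cons hvw p).IsPath := hp.cons hvp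
          have hap' : a.2 ∉ (Walk.cons hvw p).support := by simp [hav, hap]
          refine mem_pathArcs.2 ⟨Walk.cons hvw p, hP, ?_, by simp [hpl], hadj, hap', ?_⟩
          · exact notMem_support_of_snd_ne hg hxv _ hP (by simp; omega) (by simpa using hwx)
          · intro hax
            have hPc := hP.concat hap' hadj
            have := notMem_support_of_snd_ne hg hxv _ hPc (by simp; omega)
              (by simpa using hwx)
            rw [← hax] at this
            simp at this

/-- The final arc starts on level `l` around `v` and does not descend, so the linear bound on such
edges applies. -/
theorem nonBacktrackingCount_succ_le {k l : ℕ} (hl : 2 ≤ l) (hkl : l < k)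
    (hg : ∀ m, 3 ≤ m → m ≤ 2 * l → (cycleGraph m).Free G) (hG : (cycleGraph (2 * k)).Free G)
    {x v : V} (hxv : G.Adj x v) : G.nonBacktrackingCount (l + 1) x v ≤
      2 ^ l * (1 + 4 * k * l) * (2 * Fintype.card V) := by
  classical
  refine (nonBacktrackingCount_le_card_pathArcs hg l le_rfl (by omega) hxv).trans ?_
  have hk := sum_card_adj_level_le (by omega) hkl hG (v := v)
    ({u | G.dist v u = l} : Finset V) ({z | l ≤ G.dist v z} : Finset V) (by simp) (by simp)
  calc _ ≤ (({z | l ≤ G.dist v z} : Finset V).sigma fun z =>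
        ({u | G.dist v u = l} : Finset V).filter fun u => G.Adj u z).card := by
        refine Finset.card_le_card_of_injOn (fun a => ⟨a.2, a.1⟩) ?_ ?_
        · intro a ha
          obtain ⟨p, hp, hxp, hpl, hadj, hap, hax⟩ := mem_pathArcs.1 ha
          have h1 := dist_eq_length_of_isPath hg p hp (by omega)
          -- A path of length below `l` and one of length `l + 1` have total length at most 2l, so
          -- they would coincide.
          have h2 : l ≤ G.dist v a.2 := by
            by_contra hlt
            obtain ⟨r, hr, hrl⟩ := 
              Reachable.exists_path_of_dist (⟨p.concat hadj⟩ : G.Reachable v a.2)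
            have e := congrArg Walk.length (Walk.IsPath.eq_of_cycleGraph_free hg r _ hr
              (hp.concat hap hadj) (by simp; omega))
            simp at e
            omega
          simp [h1, h2, hadj, hpl]
        · rintro ⟨a, b⟩ _ ⟨c, d⟩ _ h
          simp at h
          simp [h]
    _ ≤ _ := by
        rw [Finset.card_sigma]
        refine hk.trans (Nat.mul_le_mul_left _ ?_)
        rw [two_mul]
        exact Nat.add_le_add (Finset.card_le_univ _) (Finset.card_le_univ _)

/-! ### Odd cycles through a vertex -/

theorem IsLabelledCycle.mem_pathEnds {l : ℕ} {f : ZMod (2 * l + 1) → V} (hl : 2 ≤ l)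
    (hg : ∀ m, 3 ≤ m → m ≤ 2 * l → (cycleGraph m).Free G) (h : G.IsLabelledCycle (2 * l + 1) f)
    {x : V} (hx : G.Adj x (f 0)) (h1 : f 1 ≠ x) : f l ∈ G.pathEnds l x (f 0) := by
  obtain ⟨p, hp, hpl, hv⟩ := h.exists_isPath 0 l (by omega)
  have := notMem_support_of_snd_ne hg hx p hp (by omega)
    (by rw [hv 1 (by omega)]; simpa using h1)
  rw [SimpleGraph.mem_pathEnds]
  refine ⟨p.copy rfl (by simp), by simpa using hp, by simpa using this, by simpa using hpl⟩

open Classical in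
/-- The labelled cycles of odd length `2 * l + 1` with base point `v`. -/
noncomputable def labelledCyclesAt (G : SimpleGraph V) (l : ℕ) (v : V) :
    Finset (ZMod (2 * l + 1) → V) :=
  {f | G.IsLabelledCycle (2 * l + 1) f ∧ f 0 = v}

theorem mem_labelledCyclesAt {l : ℕ} {v : V} {f : ZMod (2 * l + 1) → V} :
    f ∈ G.labelledCyclesAt l v ↔ G.IsLabelledCycle (2 * l + 1) f ∧ f 0 = v := by
  simp [labelledCyclesAt]

/-- A cycle not using the edge to `x` has both ends of its opposite edge in `E`, and that edge
determines it; the linear bound is applied with `E` on both sides. A cycle through that edge is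
determined by a single element of `E`, up to orientation. -/
theorem card_labelledCyclesAt_le {k l : ℕ} (hl : 2 ≤ l) (hkl : l < k)
    (hg : ∀ m, 3 ≤ m → m ≤ 2 * l → (cycleGraph m).Free G) (hG : (cycleGraph (2 * k)).Free G)
    {x v : V} (hxv : G.Adj x v) : (G.labelledCyclesAt l v).card ≤
      (2 + 2 * (2 ^ l * (1 + 4 * k * l))) * G.nonBacktrackingCount l x v := by
  classical
  have hN : ((2 * l + 1 : ℕ) : ZMod (2 * l + 1)) = 0 := ZMod.natCast_self _
  push_cast at hN
  have hneg : -(l : ZMod (2 * l + 1)) = l + 1 := by linear_combination -hN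
  have hone : (-1 : ZMod (2 * l + 1)) ≠ 1 := by
    intro h
    have h2 : ((2 : ℕ) : ZMod (2 * l + 1)) = (0 : ℕ) := by push_cast; linear_combination -h
    rw [ZMod.natCast_eq_natCast_iff', Nat.mod_eq_of_lt (by omega)] at h2
    simp at h2
  set E := G.pathEnds l x v with hE
  set S := G.labelledCyclesAt l v
  have hback : ∀ f ∈ S, f (-1) ≠ x → f (l + 1) ∈ E := by
    intro f hf h1
    obtain ⟨hf, h0⟩ := mem_labelledCyclesAt.1 hf
    have := hf.comp_neg.mem_pathEnds hl hg (x := x) (by simpa [h0] using hxv) h1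
    simpa [hneg, h0] using this
  have hforw : ∀ f ∈ S, f 1 ≠ x → f l ∈ E := by
    intro f hf h1
    obtain ⟨hf, h0⟩ := mem_labelledCyclesAt.1 hf
    have := hf.mem_pathEnds hl hg (x := x) (by simpa [h0] using hxv) h1
    simpa [h0] using this
  have hA : (S.filter fun f => f 1 = x).card ≤ E.card := by
    refine Finset.card_le_card_of_injOn (fun f => f (l + 1)) ?_ ?_
    · intro f hf
      obtain ⟨hf, h1⟩ := Finset.mem_filter.1 hf
      refine hback f hf fun h2 => hone ?_
      exact (mem_labelledCyclesAt.1 hf).1.1 (h2.trans h1.symm)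
    · intro f hf f' hf' h2
      obtain ⟨hf, h1⟩ := Finset.mem_filter.1 hf
      obtain ⟨hf', h1'⟩ := Finset.mem_filter.1 hf'
      obtain ⟨hf, h0⟩ := mem_labelledCyclesAt.1 hf
      obtain ⟨hf', h0'⟩ := mem_labelledCyclesAt.1 hf'
      refine hf.ext_of_antipodal hg hf' (h0.trans h0'.symm) ?_ h2
      -- With the value at 1 fixed to be `x`, the arc from 1 to `l + 1` has length `l` and passes
      -- through position `l`, so that value is forced too.
      have := hf.eq_on_segment hg hf' 1 (l + 1) l (by omega) le_rfl (by ring) (h1.trans h1'.symm) h2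
        (l - 1) (by omega)
      rw [Nat.cast_sub (by omega)] at this
      simpa using this
  have hB : (S.filter fun f => f (-1) = x).card ≤ E.card := by
    refine le_trans ?_ hA
    refine Finset.card_le_card_of_injOn (fun f i => f (-i)) ?_ ?_
    · intro f hf
      obtain ⟨hf, h1⟩ := Finset.mem_filter.1 hf
      obtain ⟨hf, h0⟩ := mem_labelledCyclesAt.1 hf
      exact Finset.mem_filter.2 ⟨mem_labelledCyclesAt.2 ⟨hf.comp_neg, by simpa using h0⟩, h1⟩
    · intro f _ f' _ h
      funext i
      simpa using congrFun h (-i)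
  have hdist : ∀ u ∈ E, G.dist v u = l := by
    intro u hu
    obtain ⟨p, hp, -, hpl⟩ := mem_pathEnds.1 hu
    rw [dist_eq_length_of_isPath hg p hp (by omega), hpl]
  have hC : (S.filter fun f => f 1 ≠ x ∧ f (-1) ≠ x).card ≤
      2 ^ l * (1 + 4 * k * l) * (E.card + E.card) := by
    refine le_trans ?_ (sum_card_adj_level_le (by omega) hkl hG E E hdist
      (fun u hu => (hdist u hu).ge))
    rw [← Finset.card_sigma]
    refine Finset.card_le_card_of_injOn (fun f => ⟨f (l + 1), f l⟩) ?_ ?_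
    · intro f hf
      obtain ⟨hf, h1, h2⟩ := Finset.mem_filter.1 hf
      have := (mem_labelledCyclesAt.1 hf).1.2 l
      simp [hback f hf h2, hforw f hf h1, this]
    · intro f hf f' hf' h
      obtain ⟨hf, h0⟩ := mem_labelledCyclesAt.1 (Finset.mem_filter.1 hf).1
      obtain ⟨hf', h0'⟩ := mem_labelledCyclesAt.1 (Finset.mem_filter.1 hf').1
      simp only [Sigma.mk.injEq, heq_eq_eq] at h
      exact hf.ext_of_antipodal hg hf' (h0.trans h0'.symm) h.2 h.1
  have hcover : S ⊆ (S.filter fun f => f 1 = x) ∪ ((S.filter fun f => f (-1) = x) ∪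
      (S.filter fun f => f 1 ≠ x ∧ f (-1) ≠ x)) := by
    intro f hf
    simp only [Finset.mem_union, Finset.mem_filter, hf, true_and]
    tauto
  have h1 := (Finset.card_le_card hcover).trans (Finset.card_union_le _ _)
  have h2 := Finset.card_union_le (S.filter fun f => f (-1) = x)
    (S.filter fun f => f 1 ≠ x ∧ f (-1) ≠ x)
  calc S.card ≤ E.card + (E.card + 2 ^ l * (1 + 4 * k * l) * (E.card + E.card)) := by omega
    _ = (2 + 2 * (2 ^ l * (1 + 4 * k * l))) * E.card := by ring
    _ ≤ _ := Nat.mul_le_mul_left _ (card_pathEnds_le l x v)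

/-! ### Deleting vertices on few cycles -/

/-- Some vertex lies on few odd cycles of the shortest length. -/
theorem exists_card_labelledCyclesAt_lt {k l Q : ℕ} (hl : 2 ≤ l) (hkl : l < k)
    (hg : ∀ m, 3 ≤ m → m ≤ 2 * l → (cycleGraph m).Free G) (hG : (cycleGraph (2 * k)).Free G)
    (hQ : (2 ^ l * (1 + 4 * k * l) * (2 * Fintype.card V)) ^ l < Q ^ (l + 1))
    (hne : ∃ x v, G.Adj x v) : ∃ v, (∃ x, G.Adj x v) ∧
      (G.labelledCyclesAt l v).card < (2 + 2 * (2 ^ l * (1 + 4 * k * l))) * Q := by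
  by_contra hcon
  push Not at hcon
  obtain ⟨x, v, hxv⟩ := hne
  have h1 : ∀ x v, G.Adj x v → Q ≤ G.nonBacktrackingCount l x v := by
    intro x v hxv
    exact Nat.le_of_mul_le_mul_left ((hcon v ⟨x, hxv⟩).trans
      (card_labelledCyclesAt_le hl hkl hg hG hxv)) (by omega)
  -- Walks of length l(l+1) are counted as `l + 1` blocks of length `l`, then as `l` blocks of
  -- length `l + 1`.
  have h2 := pow_le_nonBacktrackingCount h1 (l + 1) hxv
  have h3 := nonBacktrackingCount_le_pow
    (fun x v h => nonBacktrackingCount_succ_le hl hkl hg hG h) l hxv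
  rw [mul_comm] at h2
  exact absurd (h2.trans h3) (not_le.2 hQ)

open Classical in
-- Induction on the number of non-isolated vertices: isolating a vertex on few cycles keeps the
-- vertex type, and every destroyed cycle is one of the 2l + 1 rotations of a cycle based there.
theorem card_labelledCycles_le {k l Q : ℕ} (hl : 2 ≤ l) (hkl : l < k)
    (hQ : (2 ^ l * (1 + 4 * k * l) * (2 * Fintype.card V)) ^ l < Q ^ (l + 1)) (s : ℕ) :
    ∀ G : SimpleGraph V, (∀ m, 3 ≤ m → m ≤ 2 * l → (cycleGraph m).Free G) →
    (cycleGraph (2 * k)).Free G → ({v | ∃ x, G.Adj x v} : Finset V).card ≤ s →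
    ({f | G.IsLabelledCycle (2 * l + 1) f} : Finset (ZMod (2 * l + 1) → V)).card ≤
      s * ((2 * l + 1) * ((2 + 2 * (2 ^ l * (1 + 4 * k * l))) * Q)) := by
  induction s with
  | zero =>
    intro G _ _ hs
    rw [zero_mul, Nat.le_zero, Finset.card_eq_zero, Finset.filter_eq_empty_iff]
    rw [Nat.le_zero, Finset.card_eq_zero, Finset.filter_eq_empty_iff] at hs
    intro f _ hf
    exact hs (Finset.mem_univ (f (0 + 1))) ⟨_, hf.2 0⟩
  | succ s ih =>
    intro G hg hG hs
    by_cases hne : ∃ x v, G.Adj x v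
    · obtain ⟨v, hv, hvc⟩ := exists_card_labelledCyclesAt_lt hl hkl hg hG hQ hne
      let G' : SimpleGraph V :=
        { Adj := fun a b => G.Adj a b ∧ a ≠ v ∧ b ≠ v
          symm := ⟨fun a b h => ⟨h.1.symm, h.2.2, h.2.1⟩⟩
          loopless := ⟨fun a h => G.irrefl h.1⟩ }
      have hle : G' ≤ G := fun a b h => h.1
      have hG' := ih G' (fun m h1 h2 h => hg m h1 h2 (h.mono_right hle))
        (fun h => hG (h.mono_right hle)) (by
          refine Nat.le_of_lt_succ (lt_of_lt_of_le (Finset.card_lt_card ?_) hs)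
          rw [Finset.ssubset_iff_of_subset]
          · exact ⟨v, by simpa using hv, by simp [G']⟩
          · intro u hu
            simp only [Finset.mem_filter, Finset.mem_univ, true_and] at hu ⊢
            obtain ⟨x, hx⟩ := hu
            exact ⟨x, hx.1⟩)
      have hcover : ({f | G.IsLabelledCycle (2 * l + 1) f} : Finset (ZMod (2 * l + 1) → V)) ⊆
          ({f | G'.IsLabelledCycle (2 * l + 1) f} : Finset (ZMod (2 * l + 1) → V)) ∪
          (Finset.univ : Finset (ZMod (2 * l + 1))).biUnion fun i =>
            (G.labelledCyclesAt l v).image fun f j => f (j - i) := by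
        intro f hf
        simp only [Finset.mem_filter, Finset.mem_univ, true_and] at hf
        rw [Finset.mem_union, Finset.mem_biUnion]
        by_cases hi : ∃ i, f i = v
        · obtain ⟨i, hi⟩ := hi
          refine Or.inr ⟨i, Finset.mem_univ _, Finset.mem_image.2 ⟨fun j => f (j + i),
            mem_labelledCyclesAt.2 ⟨hf.comp_add i, by simpa using hi⟩, by simp⟩⟩
        · push Not at hi
          left
          simp only [Finset.mem_filter, Finset.mem_univ, true_and]
          exact ⟨hf.1, fun i => ⟨hf.2 i, hi _, hi _⟩⟩
      refine (Finset.card_le_card hcover).trans ((Finset.card_union_le _ _).trans ?_)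
      rw [Nat.succ_mul s]
      have hU : ∀ i ∈ (Finset.univ : Finset (ZMod (2 * l + 1))),
          ((G.labelledCyclesAt l v).image fun f j => f (j - i)).card ≤
            (2 + 2 * (2 ^ l * (1 + 4 * k * l))) * Q :=
        fun i _ => Finset.card_image_le.trans hvc.le
      have hU' := Finset.card_biUnion_le_card_mul _ _ _ hU
      rw [Finset.card_univ, ZMod.card] at hU'
      exact Nat.add_le_add hG' hU'
    · have : ({f | G.IsLabelledCycle (2 * l + 1) f} : Finset (ZMod (2 * l + 1) → V)) = ∅ := by
        rw [Finset.filter_eq_empty_iff]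
        intro f _ hf
        exact hne ⟨_, _, hf.2 0⟩
      rw [this]
      simp

open Classical in
theorem labelledCopyCount_cycleGraph_le (G : SimpleGraph V) {l : ℕ} (hl : 0 < l) :
    G.labelledCopyCount (cycleGraph (2 * l + 1)) ≤
      ({f | G.IsLabelledCycle (2 * l + 1) f} : Finset (ZMod (2 * l + 1) → V)).card := by
  rw [labelledCopyCount]
  refine (@Finset.card_univ _ (_)).symm.trans_le ?_
  let F : Copy (cycleGraph (2 * l + 1)) G → ZMod (2 * l + 1) → V :=
    fun φ i => φ.toHom ⟨i.val, ZMod.val_lt i⟩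
  refine Finset.card_le_card_of_injOn F ?_ ?_
  · intro φ _
    simp only [Finset.coe_filter, Finset.mem_univ, true_and, Set.mem_ofPred_eq]
    exact .of_copy (by omega) φ
  · intro φ _ ψ _ h
    ext i
    have hi : (⟨(i.val : ZMod (2 * l + 1)).val, ZMod.val_lt _⟩ : Fin (2 * l + 1)) = i :=
      Fin.ext (ZMod.val_natCast_of_lt i.isLt)
    have := congrFun h (i.val : ZMod (2 * l + 1))
    simp only [F, hi] at this
    exact this

end SimpleGraph

/-! ### Lower bound: greedy addition of spread-out cycles -/

namespace SimpleGraph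

section

variable {V : Type*} {G : SimpleGraph V}

theorem exists_walk_of_forall_adj (g : ℕ → V) (t : ℕ) (h : ∀ r < t, G.Adj (g r) (g (r + 1))) :
    ∃ p : G.Walk (g 0) (g t), p.length = t := by
  induction t with
  | zero => exact ⟨Walk.nil, rfl⟩
  | succ t ih =>
    obtain ⟨p, hp⟩ := ih fun r hr => h r (by omega)
    exact ⟨p.concat (h t (by omega)), by simp [hp]⟩

/-- The only cycles in a cycle graph are the full ones. -/
theorem IsLabelledCycle.eq_of_cycleGraph {N m : ℕ} (hm : 3 ≤ m) (hN : 3 ≤ N) {f : ZMod m → Fin N}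
    (h : (cycleGraph N).IsLabelledCycle m f) : m = N := by
  have : NeZero m := ⟨by omega⟩
  obtain ⟨n, rfl⟩ : ∃ n, N = n + 2 := ⟨N - 2, by omega⟩
  have h2 : (1 : ZMod m) + 1 ≠ 0 := by
    intro h
    have : ((2 : ℕ) : ZMod m) = (0 : ℕ) := by push_cast; linear_combination h
    rw [ZMod.natCast_eq_natCast_iff', Nat.mod_eq_of_lt (by omega)] at this
    simp at this
  -- The neighbours of `f i` along the cycle are distinct, so they exhaust its two neighbours in the
  -- cycle graph.
  have hclosed : ∀ a, a ∈ Set.range f → a + 1 ∈ Set.range f := by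
    rintro _ ⟨i, rfl⟩
    have hs := h.2 i
    have hp := (h.2 (i - 1)).symm
    rw [sub_add_cancel] at hp
    have hne : f (i + 1) ≠ f (i - 1) := fun e => h2 (by
      have := h.1 e
      linear_combination this)
    rw [← mem_neighborSet, cycleGraph_neighborSet] at hs hp
    rcases hs with hs | hs
    · rcases hp with hp | hp
      · exact absurd (hs.trans hp.symm) hne
      · exact ⟨_, hp⟩
    · exact ⟨_, hs⟩
  have hsurj : Function.Surjective f := by
    have key : ∀ b : Fin (n + 2), f 0 + b ∈ Set.range f := by
      intro b
      refine Fin.induction ⟨0, by simp⟩ (fun i hi => ?_) b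
      have := hclosed _ hi
      rwa [add_assoc, Fin.coeSucc_eq_succ] at this
    intro b
    simpa using key (b - f 0)
  have := Fintype.card_of_bijective ⟨h.1, hsurj⟩
  rwa [ZMod.card, Fintype.card_fin] at this

/-- Adding a cycle through vertices which are far apart creates no other short cycle. -/
theorem cycleGraph_free_sup_map {N m r : ℕ} (hN : 3 ≤ N) (hm : 3 ≤ m) (hmr : m ≤ r) (hmN : m ≠ N)
    (s : Fin N ↪ V) (hs : ∀ i j, i ≠ j → ∀ p : G.Walk (s i) (s j), r < p.length)
    (hG : (cycleGraph m).Free G) : (cycleGraph m).Free (G ⊔ (cycleGraph N).map s) := by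
  have : NeZero m := ⟨by omega⟩
  intro hcon
  obtain ⟨f, hf⟩ := (cycleGraph_isContained_iff_isLabelledCycle hm).1 hcon
  have hnew : ∀ i, ¬ G.Adj (f i) (f (i + 1)) →
      ∃ a b, (cycleGraph N).Adj a b ∧ s a = f i ∧ s b = f (i + 1) := by
    intro i hi
    exact (map_adj _ _ _ _).1 ((hf.2 i).resolve_left hi)
  by_cases hold : ∀ i, G.Adj (f i) (f (i + 1))
  · exact hG ((cycleGraph_isContained_iff_isLabelledCycle hm).2 ⟨f, hf.1, hold⟩)
  push Not at hold
  obtain ⟨i₀, hi₀⟩ := hold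
  -- Otherwise a run of old edges between two new ones would join distinct vertices of `s` by a walk
  -- shorter than `m`. Hence a cycle with one new edge has only new edges.
  have hstep : ∀ i, ¬ G.Adj (f i) (f (i + 1)) → ¬ G.Adj (f (i + 1)) (f (i + 1 + 1)) := by
    classical
    intro i hi hi'
    have hex : ∃ t : ℕ, ¬ G.Adj (f (i + 1 + t)) (f (i + 1 + t + 1)) := by
      refine ⟨m - 1, ?_⟩
      have : i + 1 + (m - 1 : ℕ) = i := by
        rw [Nat.cast_sub (by omega), ZMod.natCast_self]
        push_cast
        ring
      rwa [this]
    have hspec := Nat.find_spec hex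
    have hmin := fun r => Nat.find_min hex (m := r)
    have hle : Nat.find hex ≤ m - 1 := by
      apply Nat.find_min'
      have : i + 1 + (m - 1 : ℕ) = i := by
        rw [Nat.cast_sub (by omega), ZMod.natCast_self]
        push_cast
        ring
      rwa [this]
    set t := Nat.find hex with ht
    have ht0 : t ≠ 0 := by
      intro h0
      rw [h0] at hspec
      simp at hspec
      exact hspec hi'
    obtain ⟨p, hp⟩ := exists_walk_of_forall_adj (G := G) (fun r => f (i + 1 + (r : ℕ))) t (by
      intro r hr
      have := not_not.1 (hmin r hr)
      rwa [add_assoc (i + 1), ← Nat.cast_succ] at this)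
    obtain ⟨_, b, -, -, hb⟩ := hnew i hi
    obtain ⟨a, _, -, ha, -⟩ := hnew _ hspec
    have hne : b ≠ a := by
      rintro rfl
      have := hf.1 (hb.symm.trans ha)
      have h0 : ((t : ℕ) : ZMod m) = (0 : ℕ) := by push_cast; linear_combination -this
      rw [ZMod.natCast_eq_natCast_iff', Nat.mod_eq_of_lt (by omega), Nat.zero_mod] at h0
      exact ht0 h0
    have := hs b a hne (p.copy (by simp [hb]) ha.symm)
    rw [Walk.length_copy, hp] at this
    omega
  have hall : ∀ i, ¬ G.Adj (f i) (f (i + 1)) := by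
    have key : ∀ t : ℕ, ¬ G.Adj (f (i₀ + t)) (f (i₀ + t + 1)) := by
      intro t
      induction t with
      | zero => simpa using hi₀
      | succ t ih =>
        have := hstep _ ih
        rwa [add_assoc i₀, ← Nat.cast_succ] at this
    intro i
    have := key (i - i₀).val
    rwa [ZMod.natCast_zmod_val, add_sub_cancel] at this
  have hg : ∀ i, ∃ a, s a = f i := fun i => by
    obtain ⟨a, _, -, ha, -⟩ := hnew i (hall i)
    exact ⟨a, ha⟩
  choose g hg using hg
  refine hmN (IsLabelledCycle.eq_of_cycleGraph hm hN (f := g) ⟨?_, ?_⟩)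
  · intro i j hij
    exact hf.1 (by rw [← hg, ← hg, hij])
  · intro i
    obtain ⟨a, b, hab, ha, hb⟩ := hnew i (hall i)
    rw [s.injective ((hg i).trans ha.symm), s.injective ((hg (i + 1)).trans hb.symm)]
    exact hab

end

variable {V : Type*} [Fintype V]

theorem copyCount_lt_copyCount_of_lt {W : Type*} {G G' : SimpleGraph V} (H : SimpleGraph W)
    (hle : G ≤ G') (φ : Copy H G') (hφ : ∃ a b, H.Adj a b ∧ ¬ G.Adj (φ a) (φ b)) :
    G.copyCount H < G'.copyCount H := by
  classical
  rw [copyCount, copyCount]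
  set F : G.Subgraph → G'.Subgraph := Subgraph.map (Hom.ofLE hle) with hF
  have hinj : Function.Injective F := by
    intro S T hST
    have hadj : ∀ S : G.Subgraph, ∀ a b, (F S).Adj a b ↔ S.Adj a b := by
      intro S a b
      simp [hF, Relation.Map]
    have hverts : ∀ S : G.Subgraph, (F S).verts = S.verts := by
      intro S
      simp [hF]
    ext a b
    · rw [← hverts S, hST, hverts]
    · rw [← hadj S, hST, hadj]
  rw [← Finset.card_image_of_injective _ hinj]
  refine Finset.card_lt_card ((Finset.ssubset_iff_of_subset ?_).2 ⟨φ.toSubgraph, ?_, ?_⟩)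
  · intro S hS
    obtain ⟨T, hT, rfl⟩ := Finset.mem_image.1 hS
    obtain ⟨e⟩ := (Finset.mem_filter.1 hT).2
    exact Finset.mem_filter.2 ⟨Finset.mem_univ _,
      ⟨e.trans ((Copy.ofLE G G' hle).isoSubgraphMap T)⟩⟩
  · exact Finset.mem_filter.2 ⟨Finset.mem_univ _, ⟨φ.isoToSubgraph⟩⟩
  · intro hmem
    obtain ⟨T, -, hT⟩ := Finset.mem_image.1 hmem
    obtain ⟨a, b, hab, hn⟩ := hφ
    have h1 : φ.toSubgraph.Adj (φ a) (φ b) := by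
      simp only [Copy.toSubgraph, Subgraph.map_adj]
      exact ⟨a, b, hab, rfl, rfl⟩
    rw [← hT, hF, Subgraph.map_adj] at h1
    obtain ⟨c, d, hcd, hc, hd⟩ := h1
    apply hn
    rw [← hc, ← hd]
    exact hcd.adj_sub

open Classical in
theorem card_ball_le {G : SimpleGraph V} {D : ℕ}
    (hD : ∀ v, ({w | G.Adj v w} : Finset V).card ≤ D) (r : ℕ) (v : V) :
    ({w | ∃ p : G.Walk v w, p.length ≤ r} : Finset V).card ≤ (D + 1) ^ r := by
  induction r with
  | zero =>
    rw [pow_zero, Finset.card_le_one]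
    have : ∀ w ∈ ({w | ∃ p : G.Walk v w, p.length ≤ 0} : Finset V), v = w := by
      intro w hw
      obtain ⟨p, hp⟩ := (Finset.mem_filter.1 hw).2
      exact Walk.eq_of_length_eq_zero (Nat.le_zero.1 hp)
    intro a ha b hb
    rw [← this a ha, ← this b hb]
  | succ r ih =>
    have hsub : ({w | ∃ p : G.Walk v w, p.length ≤ r + 1} : Finset V) ⊆
        ({w | ∃ p : G.Walk v w, p.length ≤ r} : Finset V).biUnion fun u =>
          insert u ({w | G.Adj u w} : Finset V) := by
      intro w hw
      obtain ⟨p, hp⟩ := (Finset.mem_filter.1 hw).2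
      rw [Finset.mem_biUnion]
      rcases Nat.lt_or_ge r p.length with hlt | hge
      · have hnil : ¬ p.Nil := by
          rw [Walk.not_nil_iff_lt_length]
          omega
        have hq : ∃ q : G.Walk v p.penultimate, q.length ≤ r :=
          ⟨p.dropLast, by rw [Walk.length_dropLast]; omega⟩
        refine ⟨p.penultimate, Finset.mem_filter.2 ⟨Finset.mem_univ _, hq⟩, ?_⟩
        · have : G.Adj p.penultimate w := p.adj_penultimate hnil
          simp [this]
      · exact ⟨w, Finset.mem_filter.2 ⟨Finset.mem_univ _, p, hge⟩, Finset.mem_insert_self _ _⟩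
    refine (Finset.card_le_card hsub).trans ((Finset.card_biUnion_le_card_mul _ _ (D + 1) ?_).trans
      (Nat.mul_le_mul_right _ ih))
    intro u _
    exact (Finset.card_insert_le _ _).trans (Nat.add_le_add_right (hD u) 1)

open Classical in
/-- Greedy choice of elements which are pairwise not close. -/
theorem exists_pairwise_not_of_card_le (near : V → V → Prop) (hsymm : ∀ v w, near v w → near w v)
    {B : ℕ} (hB0 : 0 < B) (hB : ∀ v, ({w | near v w} : Finset V).card ≤ B) (L : Finset V) (N : ℕ)
    (hN : N * B ≤ L.card) :
    ∃ s : Fin N → V, (∀ i, s i ∈ L) ∧ ∀ i j, i ≠ j → ¬ near (s i) (s j) := by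
  induction N with
  | zero => exact ⟨Fin.elim0, fun i => i.elim0, fun i => i.elim0⟩
  | succ N ih =>
    rw [Nat.succ_mul] at hN
    obtain ⟨s, hsL, hs⟩ := ih (by omega)
    have hcard := Finset.card_biUnion_le_card_mul (Finset.univ : Finset (Fin N))
      (fun i => ({w | near (s i) w} : Finset V)) B fun i _ => hB (s i)
    rw [Finset.card_univ, Fintype.card_fin] at hcard
    obtain ⟨w, hwL, hw⟩ := Finset.exists_mem_notMem_of_card_lt_card
      (lt_of_le_of_lt hcard (by omega : N * B < L.card))
    simp only [Finset.mem_biUnion, Finset.mem_univ, true_and, Finset.mem_filter, not_exists] at hw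
    refine ⟨Fin.cons w s, fun i => ?_, fun i j => ?_⟩
    · refine Fin.cases ?_ (fun i => ?_) i
      · simpa using hwL
      · simpa using hsL i
    · refine Fin.cases ?_ (fun i => ?_) i <;> refine Fin.cases ?_ (fun j => ?_) j
      · simp
      · intro _ h
        simp only [Fin.cons_zero, Fin.cons_succ] at h
        exact hw j (hsymm _ _ h)
      · intro _ h
        simp only [Fin.cons_zero, Fin.cons_succ] at h
        exact hw i h
      · intro hij h
        simp only [Fin.cons_succ] at h
        exact hs i j (fun e => hij (by rw [e])) h

open Classical in
/-- Degrees after adding a cycle through prescribed vertices. -/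
theorem card_adj_sup_map_cycleGraph_le {N : ℕ} (hN : 2 ≤ N) (G : SimpleGraph V) (s : Fin N ↪ V)
    (v : V) : ({w | (G ⊔ (cycleGraph N).map s).Adj v w} : Finset V).card ≤
      ({w | G.Adj v w} : Finset V).card + if v ∈ Set.range s then 2 else 0 := by
  obtain ⟨n, rfl⟩ : ∃ n, N = n + 2 := ⟨N - 2, by omega⟩
  split_ifs with hv
  · obtain ⟨a, rfl⟩ := hv
    have hsub : ({w | (G ⊔ (cycleGraph (n + 2)).map s).Adj (s a) w} : Finset V) ⊆
        ({w | G.Adj (s a) w} : Finset V) ∪ {s (a - 1), s (a + 1)} := by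
      intro w hw
      simp only [Finset.mem_filter, Finset.mem_univ, true_and, Finset.mem_union,
        Finset.mem_insert, Finset.mem_singleton] at hw ⊢
      rcases hw with hw | hw
      · exact Or.inl hw
      · right
        obtain ⟨a', b, hab, ha, rfl⟩ := (map_adj _ _ _ _).1 hw
        rw [s.injective ha, ← mem_neighborSet, cycleGraph_neighborSet] at hab
        rcases hab with hab | hab
        · exact Or.inl (congrArg s hab)
        · exact Or.inr (congrArg s hab)
    exact (Finset.card_le_card hsub).trans ((Finset.card_union_le _ _).trans
      (Nat.add_le_add_left Finset.card_le_two _))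
  · refine Finset.card_le_card fun w hw => ?_
    simp only [Finset.mem_filter, Finset.mem_univ, true_and] at hw ⊢
    rcases hw with hw | hw
    · exact hw
    · obtain ⟨a, b, -, ha, -⟩ := (map_adj _ _ _ _).1 hw
      exact absurd ⟨a, ha⟩ hv

open Classical in
/-- Greedy construction of graphs with many cycles of length `N` but no other short cycles. -/
theorem exists_graph_many_cycles {N r M : ℕ} (hN : 3 ≤ N) (hr : 1 ≤ r)
    (hM : 2 * (N * (2 * M + 1) ^ r) ≤ Fintype.card V) (t : ℕ)
    (ht : 2 * (N * t) ≤ Fintype.card V * M) :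
    ∃ (G : SimpleGraph V) (c : V → ℕ), (∀ v, ({w | G.Adj v w} : Finset V).card ≤ 2 * c v) ∧
      (∀ v, c v ≤ M) ∧ ∑ v, c v = N * t ∧
      (∀ m, 3 ≤ m → m ≤ r → m ≠ N → (cycleGraph m).Free G) ∧ t ≤ G.copyCount (cycleGraph N) := by
  induction t with
  | zero =>
    refine ⟨⊥, fun _ => 0, by simp, by simp, by simp, fun m hm _ _ h => ?_, Nat.zero_le _⟩
    obtain ⟨f, hf⟩ := (cycleGraph_isContained_iff_isLabelledCycle hm).1 h
    exact hf.2 0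
  | succ t ih =>
    rw [Nat.mul_succ] at ht
    obtain ⟨G, c, hdeg, hcM, hsum, hfree, hcount⟩ := ih (by omega)
    set L : Finset V := {v | c v < M} with hL
    -- Here `c` counts the added cycles through each vertex. Its total is at most half of M times
    -- the number of vertices, so at least half the vertices still have room.
    have hLcard : N * (2 * M + 1) ^ r ≤ L.card := by
      have h1 : (Lᶜ).card * M ≤ N * t := by
        rw [← hsum, ← smul_eq_mul]
        refine (Finset.card_nsmul_le_sum _ c M fun v hv => ?_).trans
          (Finset.sum_le_sum_of_subset (Finset.subset_univ _))
        simpa [hL] using hv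
      have h2 := Finset.card_add_card_compl L
      have hMpos : 0 < M := by
        rcases Nat.eq_zero_or_pos M with h0 | h0
        · rw [h0] at ht; omega
        · exact h0
      have h3 : 2 * (Lᶜ).card ≤ Fintype.card V := by
        refine Nat.le_of_mul_le_mul_right ?_ hMpos
        calc 2 * (Lᶜ).card * M = 2 * ((Lᶜ).card * M) := by ring
          _ ≤ _ := by omega
      omega
    have hball := card_ball_le (G := G) (D := 2 * M)
      (fun v => (hdeg v).trans (Nat.mul_le_mul_left _ (hcM v))) r
    obtain ⟨s, hsL, hs⟩ := exists_pairwise_not_of_card_le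
      (fun v w => ∃ p : G.Walk v w, p.length ≤ r)
      (fun v w ⟨p, hp⟩ => ⟨p.reverse, by simpa using hp⟩) (by positivity) hball L N hLcard
    have hfar : ∀ i j, i ≠ j → ∀ p : G.Walk (s i) (s j), r < p.length := fun i j hij p => by
      by_contra hp
      exact hs i j hij ⟨p, by omega⟩
    have hinj : Function.Injective s := fun i j hij => by
      by_contra hne
      have := hfar i j hne (Walk.nil.copy rfl hij)
      simp at this
    let e : Fin N ↪ V := ⟨s, hinj⟩
    refine ⟨G ⊔ (cycleGraph N).map e, fun v => c v + if v ∈ Set.range e then 1 else 0, ?_, ?_, ?_,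
      ?_, ?_⟩
    · intro v
      have h1 := card_adj_sup_map_cycleGraph_le (by omega) G e v
      have h2 := hdeg v
      refine le_trans (le_of_eq ?_) (h1.trans ?_)
      · congr!
      · dsimp only
        split_ifs <;> omega
    · intro v
      dsimp only
      split_ifs with hv
      · obtain ⟨i, rfl⟩ := hv
        have := hsL i
        rw [hL, Finset.mem_filter] at this
        exact this.2
      · exact hcM v
    · rw [Finset.sum_add_distrib, hsum, Finset.sum_boole, Nat.mul_succ]
      have : ({v | v ∈ Set.range e} : Finset V) = Finset.univ.map e := by
        ext v
        simp
      rw [this]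
      simp
    · intro m hm hmr hmN
      exact cycleGraph_free_sup_map hN hm hmr hmN e hfar (hfree m hm hmr hmN)
    · refine lt_of_le_of_lt hcount (copyCount_lt_copyCount_of_lt _ le_sup_left
        ⟨⟨s, fun {a b} hab => Or.inr ((map_adj _ _ _ _).2 ⟨a, b, hab, rfl, rfl⟩)⟩, hinj⟩ ?_)
      have hadj : (cycleGraph N).Adj ⟨0, by omega⟩ ⟨1, by omega⟩ := by
        rw [cycleGraph_adj']
        right
        rw [Fin.val_sub]
        simp only [Nat.sub_zero]
        rw [Nat.add_mod_left, Nat.mod_eq_of_lt (by omega)]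
      -- The edge is new because its ends were at distance more than `r`, which is at least 1.
      refine ⟨_, _, hadj, fun h => ?_⟩
      have := hfar _ _ hadj.ne h.toWalk
      simp at this
      omega

end SimpleGraph

/-! ### Asymptotic bounds -/

theorem familyFree_cycleFamily_iff {A : Set ℕ} {V : Type*} {G : SimpleGraph V} :
    FamilyFree (cycleFamily A) G ↔ ∀ a ∈ A, (SimpleGraph.cycleGraph a).Free G := by
  constructor
  · exact fun h a ha => h ⟨a, SimpleGraph.cycleGraph a⟩ ⟨a, ha, rfl⟩
  · rintro h _ ⟨a, ha, rfl⟩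
    exact h a ha

theorem generalizedTuran_oddCycle_le {k l : ℕ} (hl : 2 ≤ l) (hkl : l < k) :
    (fun n : ℕ => (generalizedTuran n (SimpleGraph.cycleGraph (2 * l + 1))
        (cycleFamily (Set.Icc 3 (2 * l) ∪ {2 * k})) : ℝ)) =O[atTop]
      fun n : ℕ => (n : ℝ) ^ (1 + (l : ℝ) / ((l : ℝ) + 1)) := by
  classical
  set C : ℕ := 2 ^ l * (1 + 4 * k * l) with hC
  have hC1 : 1 ≤ C := Nat.mul_pos (by positivity) (by omega)
  set e : ℝ := (l : ℝ) / ((l : ℝ) + 1) with he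
  have he0 : 0 ≤ e := by positivity
  refine IsBigO.of_bound ((2 * l + 1) * ((2 + 2 * C) * (2 * (2 * C : ℝ) ^ e))) ?_
  filter_upwards [eventually_ge_atTop 1] with n hn
  set y : ℝ := 2 * C * n with hy
  have hn1 : (1 : ℝ) ≤ n := by exact_mod_cast hn
  have hC1' : (1 : ℝ) ≤ C := by exact_mod_cast hC1
  have hy1 : 1 ≤ y := by rw [hy]; nlinarith
  have hye : 1 ≤ y ^ e := Real.one_le_rpow hy1 he0
  -- Adding 1 to the floor makes Q^(l+1) > (2Cn)^l strict, while `Q` stays within a factor 2 of `y ^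
  -- e`.
  set Q : ℕ := ⌊y ^ e⌋₊ + 1 with hQdef
  have hQlt : y ^ e < Q := by
    rw [hQdef]
    push_cast
    exact Nat.lt_floor_add_one _
  have hQle : (Q : ℝ) ≤ 2 * y ^ e := by
    rw [hQdef]
    push_cast
    linarith [Nat.floor_le (zero_le_one.trans hye)]
  have hQ : (C * (2 * Fintype.card (Fin n))) ^ l < Q ^ (l + 1) := by
    rw [Fintype.card_fin]
    have h1 : (y ^ e) ^ (l + 1) = y ^ l := by
      rw [← Real.rpow_natCast, ← Real.rpow_mul (by linarith), ← Real.rpow_natCast, he]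
      congr 1
      push_cast
      field_simp
    have h2 : (y ^ e) ^ (l + 1) < (Q : ℝ) ^ (l + 1) :=
      pow_lt_pow_left₀ hQlt (by linarith) (by omega)
    rw [h1, hy] at h2
    have h3 : ((C * (2 * n) : ℕ) : ℝ) ^ l < (Q : ℝ) ^ (l + 1) := by
      push_cast
      rwa [show (C : ℝ) * (2 * n) = 2 * C * n by ring]
    exact_mod_cast h3
  have hex : ∃ G : SimpleGraph (Fin n), FamilyFree (cycleFamily (Set.Icc 3 (2 * l) ∪ {2 * k})) G := by
    refine ⟨⊥, familyFree_cycleFamily_iff.2 fun a ha h => ?_⟩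
    have ha3 : 3 ≤ a := by
      rcases ha with ha | ha
      · exact ha.1
      · rw [Set.mem_singleton_iff.1 ha]; omega
    obtain ⟨f, hf⟩ := (SimpleGraph.cycleGraph_isContained_iff_isLabelledCycle ha3).1 h
    exact hf.2 0
  obtain ⟨G, hG, hGc⟩ := (generalizedTuran_isGreatest n
    (SimpleGraph.cycleGraph (2 * l + 1)) _ hex).1
  rw [familyFree_cycleFamily_iff] at hG
  have hmain := SimpleGraph.card_labelledCycles_le hl hkl hQ n G
    (fun m h1 h2 => hG m (Or.inl ⟨h1, h2⟩)) (hG _ (Or.inr rfl))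
    ((Finset.card_le_univ _).trans_eq (Fintype.card_fin n))
  have hle : G.copyCount (SimpleGraph.cycleGraph (2 * l + 1)) ≤
      n * ((2 * l + 1) * ((2 + 2 * C) * Q)) :=
    SimpleGraph.copyCount_le_labelledCopyCount.trans
      ((G.labelledCopyCount_cycleGraph_le (by omega)).trans hmain)
  rw [← hGc, Real.norm_of_nonneg (by positivity), Real.norm_of_nonneg (by positivity)]
  calc (G.copyCount (SimpleGraph.cycleGraph (2 * l + 1)) : ℝ)
      ≤ n * ((2 * l + 1) * ((2 + 2 * C) * Q)) := by exact_mod_cast hle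
    _ ≤ n * ((2 * l + 1) * ((2 + 2 * C) * (2 * y ^ e))) := by gcongr
    _ = _ := by
      rw [hy, Real.mul_rpow (by positivity) (by positivity),
        Real.rpow_add (by linarith), Real.rpow_one]
      ring

theorem le_generalizedTuran_oddCycle {k l : ℕ} (hl : 2 ≤ l) (hkl : l < k) :
    (fun n : ℕ => (n : ℝ) ^ (1 + 1 / (2 * (k : ℝ) + 1))) =O[atTop]
      fun n : ℕ => (generalizedTuran n (SimpleGraph.cycleGraph (2 * l + 1))
        (cycleFamily (Set.Icc 3 (2 * l) ∪ {2 * k})) : ℝ) := by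
  set e : ℝ := 1 / (2 * (k : ℝ) + 1) with he
  have he0 : 0 < e := by positivity
  refine IsBigO.of_bound (8 * (2 * l + 1 : ℕ)) ?_
  have hlim : Tendsto (fun n : ℕ => (n : ℝ) ^ e) atTop atTop :=
    (tendsto_rpow_atTop he0).comp tendsto_natCast_atTop_atTop
  set N : ℕ := 2 * l + 1 with hN
  filter_upwards [hlim.eventually_ge_atTop ((2 * N * 3 ^ (2 * k) : ℕ) : ℝ),
    eventually_ge_atTop (4 * N)] with n hx hn
  set x : ℝ := (n : ℝ) ^ e with hxdef
  set M : ℕ := ⌊x⌋₊ with hM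
  have hx1 : 1 ≤ x := le_trans (by
    have : 1 ≤ 2 * N * 3 ^ (2 * k) := Nat.mul_pos (by omega) (by positivity)
    exact_mod_cast this) hx
  have hM1 : 1 ≤ M := Nat.le_floor (by simpa using hx1)
  have hMx : (M : ℝ) ≤ x := Nat.floor_le (by linarith)
  have hxM : x ≤ 2 * M := by
    have h1 := Nat.lt_floor_add_one x
    have h2 : (1 : ℝ) ≤ M := by exact_mod_cast hM1
    rw [← hM] at h1
    linarith
  have hxn : x ^ (2 * k + 1) = n := by
    rw [hxdef, ← Real.rpow_natCast, ← Real.rpow_mul (by positivity), he]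
    push_cast
    rw [one_div_mul_cancel (by positivity), Real.rpow_one]
  -- Since n = x^(2k+1), the balls cost about x^(2k), and the spare factor `x` absorbs the constant
  -- 2N·3^(2k). This is the source of the exponent 1/(2k+1).
  have hcard : 2 * (N * (2 * M + 1) ^ (2 * k)) ≤ Fintype.card (Fin n) := by
    rw [Fintype.card_fin]
    have h1 : ((2 * (N * (2 * M + 1) ^ (2 * k)) : ℕ) : ℝ) ≤ n := by
      calc ((2 * (N * (2 * M + 1) ^ (2 * k)) : ℕ) : ℝ)
          ≤ ((2 * (N * (3 * M) ^ (2 * k)) : ℕ) : ℝ) := by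
            have h2 : 2 * M + 1 ≤ 3 * M := by omega
            exact_mod_cast Nat.mul_le_mul_left _ (Nat.mul_le_mul_left _
              (Nat.pow_le_pow_left h2 _))
        _ = ((2 * N * 3 ^ (2 * k) : ℕ) : ℝ) * (M : ℝ) ^ (2 * k) := by
            push_cast
            ring
        _ ≤ x * x ^ (2 * k) := by gcongr
        _ = n := by rw [← hxn]; ring
    exact_mod_cast h1
  have ht : 2 * (N * (n * M / (2 * N))) ≤ Fintype.card (Fin n) * M := by
    rw [Fintype.card_fin, ← mul_assoc]
    exact Nat.mul_div_le _ _
  obtain ⟨G, -, -, -, -, hfree, hcount⟩ := SimpleGraph.exists_graph_many_cycles (V := Fin n)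
    (by omega) (by omega) hcard _ ht
  have hG : FamilyFree (cycleFamily (Set.Icc 3 (2 * l) ∪ {2 * k})) G := by
    refine familyFree_cycleFamily_iff.2 ?_
    rintro a (⟨h1, h2⟩ | rfl)
    · exact hfree a h1 (by omega) (by omega)
    · exact hfree _ (by omega) le_rfl (by omega)
  have hle : n * M / (2 * N) ≤ generalizedTuran n (SimpleGraph.cycleGraph N)
      (cycleFamily (Set.Icc 3 (2 * l) ∪ {2 * k})) :=
    hcount.trans ((generalizedTuran_isGreatest n _ _ ⟨G, hG⟩).2 ⟨G, hG, rfl⟩)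
  -- The quotient is at least 2 because 4N ≤ n, so rounding down costs at most a factor 2.
  have hnM : n * M ≤ 4 * N * (n * M / (2 * N)) := by
    have h1 := Nat.div_add_mod (n * M) (2 * N)
    have h2 := Nat.mod_lt (n * M) (show 0 < 2 * N by omega)
    have h3 : 4 * N ≤ n * M := hn.trans (Nat.le_mul_of_pos_right _ hM1)
    have h4 : 4 * N * (n * M / (2 * N)) = 2 * (2 * N * (n * M / (2 * N))) := by ring
    omega
  have hfin : n * M ≤ 4 * N * generalizedTuran n (SimpleGraph.cycleGraph N)
      (cycleFamily (Set.Icc 3 (2 * l) ∪ {2 * k})) := hnM.trans (Nat.mul_le_mul_left _ hle)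
  have hn0 : (0 : ℝ) < n := by
    have : 0 < n := by omega
    exact_mod_cast this
  rw [Real.norm_of_nonneg (by positivity), Real.norm_of_nonneg (by positivity),
    Real.rpow_add hn0, Real.rpow_one]
  have hfin' : (n : ℝ) * M ≤ 4 * N * generalizedTuran n (SimpleGraph.cycleGraph N)
      (cycleFamily (Set.Icc 3 (2 * l) ∪ {2 * k})) := by exact_mod_cast hfin
  calc (n : ℝ) * x ≤ n * (2 * M) := by gcongr
    _ = 2 * (n * M) := by ring
    _ ≤ _ := by linarith

theorem theorem2p7 (k l : ℕ) (hl : 2 ≤ l) (hkl : l < k) :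
    ((fun n : ℕ => (n : ℝ) ^ (1 + 1 / (2 * (k : ℝ) + 1))) =O[atTop]
      fun n : ℕ => (generalizedTuran n (SimpleGraph.cycleGraph (2 * l + 1))
        (cycleFamily (Set.Icc 3 (2 * l) ∪ {2 * k})) : ℝ)) ∧
    ((fun n : ℕ => (generalizedTuran n (SimpleGraph.cycleGraph (2 * l + 1))
        (cycleFamily (Set.Icc 3 (2 * l) ∪ {2 * k})) : ℝ)) =O[atTop]
      fun n : ℕ => (n : ℝ) ^ (1 + (l : ℝ) / ((l : ℝ) + 1))) :=
  ⟨le_generalizedTuran_oddCycle hl hkl, generalizedTuran_oddCycle_le hl hkl⟩
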